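/- Structures are nonempty. Let $\mathcal K$ (with strong substructure relation $\prec_{\mathcal K}$) be an abstract elementary class in a vocabulary $\tau$, let $LST(\mathcal K)$ be the least infinite cardinal $\kappa$ such that every subset $A$ of a model $M\in\mathcal K$ is contained in some $N\prec_{\mathcal K}M$ with $|N|\le|A|+\kappa$, let $\kappa$ be a cardinal with $\kappa\ge LST(\mathcal K)$ and $\kappa\ge|\tau|$ (for instance $\kappa=LST(\mathcal K)+|\tau|$), and let $\lambda=\beth_2(\kappa)^{++}$, where $\beth_2(\kappa)=2^{2^\kappa}$. Here $\mathbb L_{\lambda^+,\kappa^+}(\tau)$ is the infinitary logic in the original vocabulary $\tau$ with conjunctions and disjunctions of at most $\lambda$ formulas and quantification over at most $\kappa$ variables at once. (1) There is a sentence $\psi_{\mathcal K}$ of $\mathbb L_{\lambda^+,\kappa^+}(\tau)$ such that $\mathcal K=\mathrm{Mod}(\psi_{\mathcal K})$; that is, for every $\tau$-structure $M$, $M\in\mathcal K$ if and only if $M\models\psi_{\mathcal K}$. (2) Fix distinct elements $a^*_\alpha$ ($\alpha<\kappa\cdot\omega$). The canonical tree of $\mathcal K$ has levels $\mathcal S_n$: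 for $n\geq 1$, $\mathcal S_n$ is the set of $M\in\mathcal K$ with universe $\{a^*_\alpha\mid\alpha<\kappa\cdot n\}$ such that $M\restriction\{a^*_\alpha\mid\alpha<\kappa\cdot m\}\prec_{\mathcal K}M$ for all $0<m<n$, and $\mathcal S_0$ consists of a formal empty model, regarded as strong in every model. For $M\in\mathcal S_n$ and ordinals $\gamma$ define formulas $\varphi_{M,\gamma,n}(\bar x_n)$, $\bar x_n=\langle x_\alpha\mid\alpha<\kappa\cdot n\rangle$, by recursion on $\gamma$: $\varphi_{M,0,0}=\top$; for $n\ge1$, $\varphi_{M,0,n}$ is the conjunction of all atomic formulas and negations of atomic formulas in the variables $\bar x_n$ that hold in $M$ when each $x_\alpha$ is interpreted as $a^*_\alpha$; $\varphi_{M,\gamma,n}=\bigwedge_{\beta<\gamma}\varphi_{M,\beta,n}$ for limit $\gamma$; and $\varphi_{M,\beta+1,n}$ is $$\forall\langle z_\alpha\mid\alpha<\kappa\rangle\bigvee_{N\in\mathcal S_{n+1},\,M\prec_{\mathcal K}N}\exists\langle x_\alpha\mid\kappa\cdot n\le\alpha<\kappa\cdot(n+1)\rangle\Big[\varphi_{N,\beta,n+1}(\bar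 x_{n+1})\wedge\bigwedge_{\alpha<\kappa}\bigvee_{\delta<\kappa\cdot(n+1)}z_\alpha=x_\delta\Big].$$ Let $\varphi_{\gamma,0}$ be the sentence obtained for $n=0$. Then $\varphi_{\lambda+1,0}$ is a sentence of $\mathbb L_{\lambda^+,\kappa^+}(\tau)$, and it axiomatizes the members of $\mathcal K$ of cardinality greater than $\kappa$: for every $\tau$-structure $M$, $M\models\varphi_{\lambda+1,0}$ if and only if $M\in\mathcal K$ and $|M|>\kappa$. -/

import Mathlib

universe u

namespace AECDef

open FirstOrder Cardinal

/-! ### Infinitary logic -/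

/-- Atomic `τ`-formulas with variables in `α`. -/
inductive AtomicFormula (τ : FirstOrder.Language.{u, u}) (α : Type u) : Type u
  | equal (t₁ t₂ : τ.Term α) : AtomicFormula τ α
  | rel {k : ℕ} (R : τ.Relations k) (ts : Fin k → τ.Term α) : AtomicFormula τ α

namespace AtomicFormula

variable {τ : FirstOrder.Language.{u, u}} {α β : Type u}

/-- Truth of an atomic formula in a structure under an assignment. -/
def Realize {M : Type u} [τ.Structure M] (v : α → M) : AtomicFormula τ α → Prop
  | equal t₁ t₂ => t₁.realize v = t₂.realize v
  | rel R ts => Language.Structure.RelMap R (fun i => (ts i).realize v)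

/-- Renaming of the variables. -/
def relabel (g : α → β) : AtomicFormula τ α → AtomicFormula τ β
  | equal t₁ t₂ => equal (t₁.relabel g) (t₂.relabel g)
  | rel R ts => rel R (fun i => (ts i).relabel g)

end AtomicFormula

/-- Formulas of the logic `𝕃_{∞,∞}(τ)` whose free variables lie in the set `α`: they are built from
atomic formulas by negation, conjunctions and disjunctions of arbitrary set-indexed families, and
universal and existential quantification over a set `β` of new variables at once. -/
inductive InfFormula (τ : FirstOrder.Language.{u, u}) : Type u → Type (u + 1)
  | atom {α : Type u} (a : AtomicFormula τ α) : InfFormula τ α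
  | not {α : Type u} (φ : InfFormula τ α) : InfFormula τ α
  | conj {α ι : Type u} (φ : ι → InfFormula τ α) : InfFormula τ α
  | disj {α ι : Type u} (φ : ι → InfFormula τ α) : InfFormula τ α
  | all {α β : Type u} (φ : InfFormula τ (α ⊕ β)) : InfFormula τ α
  | ex {α β : Type u} (φ : InfFormula τ (α ⊕ β)) : InfFormula τ α

namespace InfFormula

variable {τ : FirstOrder.Language.{u, u}}

/-- Tarskian satisfaction. -/
def Realize {M : Type u} [τ.Structure M] : {α : Type u} → InfFormula τ α → (α → M) → Prop
  | _, atom a, v => a.Realize v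
  | _, not φ, v => ¬ φ.Realize v
  | _, conj φ, v => ∀ i, (φ i).Realize v
  | _, disj φ, v => ∃ i, (φ i).Realize v
  | _, all (β := β) φ, v => ∀ w : β → M, φ.Realize (Sum.elim v w)
  | _, ex (β := β) φ, v => ∃ w : β → M, φ.Realize (Sum.elim v w)

/-- The formula belongs to `𝕃_{μ,θ}(τ)`: all conjunctions and disjunctions are over fewer than `μ`
formulas, and every quantifier binds fewer than `θ` variables. -/
def InLogic (μ θ : Cardinal.{u}) : {α : Type u} → InfFormula τ α → Prop
  | _, atom _ => True
  | _, not φ => φ.InLogic μ θ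
  | _, conj (ι := ι) φ => #ι < μ ∧ ∀ i, (φ i).InLogic μ θ
  | _, disj (ι := ι) φ => #ι < μ ∧ ∀ i, (φ i).InLogic μ θ
  | _, all (β := β) φ => #β < θ ∧ φ.InLogic μ θ
  | _, ex (β := β) φ => #β < θ ∧ φ.InLogic μ θ

/-- Renaming of the free variables. -/
def relabel : {α β : Type u} → (α → β) → InfFormula τ α → InfFormula τ β
  | _, _, g, atom a => atom (a.relabel g)
  | _, _, g, not φ => not (φ.relabel g)
  | _, _, g, conj φ => conj (fun i => (φ i).relabel g)
  | _, _, g, disj φ => disj (fun i => (φ i).relabel g)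
  | _, _, g, all φ => all (φ.relabel (Sum.map g id))
  | _, _, g, ex φ => ex (φ.relabel (Sum.map g id))

/-- Truth, as the empty conjunction. -/
def top {α : Type u} : InfFormula τ α :=
  conj (ι := PEmpty.{u + 1}) PEmpty.elim

/-- Binary conjunction. -/
def and {α : Type u} (φ ψ : InfFormula τ α) : InfFormula τ α :=
  conj (ι := ULift.{u} Bool) (fun b => if b.down then φ else ψ)

/-- The formula `x = y` for variables `x` and `y`. -/
def varEq {α : Type u} (x y : α) : InfFormula τ α :=
  atom (AtomicFormula.equal (Language.Term.var x) (Language.Term.var y))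

end InfFormula

/-- Sentences: formulas without free variables. -/
abbrev InfSentence (τ : FirstOrder.Language.{u, u}) : Type (u + 1) := InfFormula τ PEmpty.{u + 1}

/-- `M ⊨ ψ`. -/
def Models {τ : FirstOrder.Language.{u, u}} (M : Type u) [τ.Structure M] (ψ : InfSentence τ) : Prop :=
  ψ.Realize (M := M) PEmpty.elim

/-! ### Abstract elementary classes -/

/-- An abstract elementary class in the vocabulary `τ`: a class `Mem` of nonempty `τ`-structures and
a strong substructure relation, where `Strong S`, for a substructure `S` of `M`, says that
`S ≺ M` in the class. For substructures `S ≤ T` of a common structure, `S ≺ T` is expressed by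
viewing `S` as a substructure of `T`, that is by `Strong (S.comap T.subtype.toHom)`. -/
structure AEC (τ : FirstOrder.Language.{u, u}) where
  Mem : ∀ (M : Type u) [τ.Structure M], Prop
  Strong : ∀ {M : Type u} [τ.Structure M], τ.Substructure M → Prop
  nonempty_of_mem : ∀ {M : Type u} [τ.Structure M], Mem M → Nonempty M
  /-- The class is closed under isomorphism. -/
  mem_of_equiv : ∀ {M N : Type u} [τ.Structure M] [τ.Structure N],
    (M ≃[τ] N) → Mem M → Mem N
  /-- The strong substructure relation is invariant under isomorphism. -/
  strong_of_equiv : ∀ {M N : Type u} [τ.Structure M] [τ.Structure N] (e : M ≃[τ] N)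
    (S : τ.Substructure M), Strong S → Strong (S.map e.toHom)
  /-- The strong substructure relation is a relation between members of the class. -/
  mem_left : ∀ {M : Type u} [τ.Structure M] (S : τ.Substructure M), Strong S → Mem S
  mem_right : ∀ {M : Type u} [τ.Structure M] (S : τ.Substructure M), Strong S → Mem M
  /-- Reflexivity. -/
  strong_refl : ∀ {M : Type u} [τ.Structure M], Mem M → Strong (⊤ : τ.Substructure M)
  /-- Transitivity: if `S ≺ T` and `T ≺ M` then `S ≺ M`. -/
  strong_trans : ∀ {M : Type u} [τ.Structure M] (S T : τ.Substructure M), S ≤ T →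
    Strong (S.comap T.subtype.toHom) → Strong T → Strong S
  /-- Coherence: if `S ⊆ T`, `S ≺ M` and `T ≺ M` then `S ≺ T`. -/
  coherence : ∀ {M : Type u} [τ.Structure M] (S T : τ.Substructure M), S ≤ T →
    Strong S → Strong T → Strong (S.comap T.subtype.toHom)
  /-- If `M` is the union of a well-ordered chain of substructures, increasing with respect to `≺`,
  then `M` belongs to the class and all members of the chain are strong in `M`. -/
  union_chain : ∀ {M : Type u} [τ.Structure M] {ι : Type u} [LinearOrder ι] [WellFoundedLT ι]
    [Nonempty ι] (S : ι → τ.Substructure M), Monotone S →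
    (∀ i j, i ≤ j → Strong ((S i).comap (S j).subtype.toHom)) →
    (⋃ i, (S i : Set M)) = Set.univ → Mem M ∧ ∀ i, Strong (S i)
  /-- If all members of an increasing chain are strong in `N`, then so is the union `T`. -/
  smoothness : ∀ {N : Type u} [τ.Structure N] {ι : Type u} [LinearOrder ι] [WellFoundedLT ι]
    [Nonempty ι] (S : ι → τ.Substructure N), Monotone S →
    (∀ i j, i ≤ j → Strong ((S i).comap (S j).subtype.toHom)) → (∀ i, Strong (S i)) →
    ∀ T : τ.Substructure N, (T : Set N) = ⋃ i, (S i : Set N) → Strong T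
  /-- The Löwenheim–Skolem–Tarski axiom. -/
  exists_lst : ∃ κ : Cardinal.{u}, ℵ₀ ≤ κ ∧ ∀ {M : Type u} [τ.Structure M], Mem M →
    ∀ A : Set M, ∃ S : τ.Substructure M, A ⊆ S ∧ Strong S ∧ #S ≤ #A + κ

namespace AEC

variable {τ : FirstOrder.Language.{u, u}} (K : AEC τ)

/-- The Löwenheim–Skolem–Tarski number: the least infinite cardinal `κ` such that every subset `A`
of a member `M` of the class is contained in some `S ≺ M` with `|S| ≤ |A| + κ`. -/
noncomputable def LST : Cardinal.{u} :=
  sInf {κ : Cardinal.{u} | ℵ₀ ≤ κ ∧ ∀ {M : Type u} [τ.Structure M], K.Mem M →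
    ∀ A : Set M, ∃ S : τ.Substructure M, A ⊆ S ∧ K.Strong S ∧ #S ≤ #A + κ}

/-! ### The canonical tree -/

/-- An index set of size `κ`: the ordinals below `κ`. -/
abbrev Block (κ : Cardinal.{u}) : Type u := κ.ord.ToType

/-- The set of indices `α < κ · n`, where `α = κ · k + ζ` with `k < n` and `ζ < κ` is represented by
the pair `(k, ζ)`. It serves as the universe `{a*_α | α < κ · n}` of the models of level `n` of the
canonical tree, and as the index set of the sequence of variables `x̄_n`. -/
abbrev Idx (κ : Cardinal.{u}) (n : ℕ) : Type u := Fin n × Block κ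

/-- The structure `s` with universe `{a*_α | α < κ · n}` belongs to the class, and its
restriction to `{a*_α | α < κ · m}` is strong in it for all `0 < m < n`. -/
def IsNode (κ : Cardinal.{u}) (n : ℕ) (s : τ.Structure (Idx κ n)) : Prop :=
  K.Mem (Idx κ n) ∧ ∀ m : ℕ, 0 < m → m < n →
    ∃ S : τ.Substructure (Idx κ n), (S : Set (Idx κ n)) = {x | (x.1 : ℕ) < m} ∧ K.Strong S

/-- The `n`-th level of the canonical tree. Level `0` consists of the formal empty model alone. -/
def Node (κ : Cardinal.{u}) : ℕ → Type u
  | 0 => PUnit.{u + 1}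
  | n + 1 => {s : τ.Structure (Idx κ (n + 1)) // K.IsNode κ (n + 1) s}

/-- The formal empty model. -/
def emptyNode (κ : Cardinal.{u}) : K.Node κ 0 := PUnit.unit

/-- `M ≺ N` for `M` in level `n` and `N` in level `n + 1` of the canonical tree: the inclusion of the
universe of `M` into that of `N` is an embedding with strong range. The formal empty model is
strong in every model. -/
def Node.Below {κ : Cardinal.{u}} : (n : ℕ) → K.Node κ n → K.Node κ (n + 1) → Prop
  | 0, _, _ => True
  | n + 1, M, N =>
    letI : τ.Structure (Idx κ (n + 1)) := M.1
    letI : τ.Structure (Idx κ (n + 2)) := N.1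
    ∃ f : Idx κ (n + 1) ↪[τ] Idx κ (n + 2),
      (∀ x, f x = (x.1.castSucc, x.2)) ∧ K.Strong f.toHom.range

/-! ### The canonical formulas -/

/-- The conjunction of the diagram of a structure with universe `α`: all atomic formulas
(`b = true`) and negations of atomic formulas (`b = false`), in the variables `x_a` for `a ∈ α`,
which hold in the structure when `x_a` is interpreted as `a`. -/
def diagram {α : Type u} (s : τ.Structure α) : InfFormula τ α :=
  letI : τ.Structure α := s
  InfFormula.conj (ι := {p : AtomicFormula τ α × Bool // p.2 = true ↔ p.1.Realize (id : α → α)})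
    (fun p => if p.1.2 then InfFormula.atom p.1.1 else InfFormula.not (InfFormula.atom p.1.1))

/-- Stage `0`: truth at level `0`, the diagram at positive levels. -/
def phiZero (κ : Cardinal.{u}) : (n : ℕ) → K.Node κ n → InfFormula τ (Idx κ n)
  | 0, _ => InfFormula.top
  | _ + 1, M => diagram M.1

/-- Given variables `x̄_n`, `z̄` and `x̄_{=n}`, the variable of `x̄_{n+1}` with a given index. -/
def nextVar (κ : Cardinal.{u}) (n : ℕ) (x : Idx κ (n + 1)) : (Idx κ n ⊕ Block κ) ⊕ Block κ :=
  if h : (x.1 : ℕ) < n then Sum.inl (Sum.inl (⟨x.1, h⟩, x.2)) else Sum.inr x.2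

/-- The successor stage, from the formulas `φ_N = φ_{N,β,n+1}`:
`∀ z̄, ⋁_{N ≻ M, N in level n + 1}, ∃ x̄_{=n}, [φ_N(x̄_{n+1}) ∧ ⋀_{α < κ} ⋁_{δ < κ·(n+1)} z_α = x_δ]`. -/
def phiSucc (κ : Cardinal.{u}) (n : ℕ) (φ : K.Node κ (n + 1) → InfFormula τ (Idx κ (n + 1)))
    (M : K.Node κ n) : InfFormula τ (Idx κ n) :=
  InfFormula.all (β := Block κ)
    (InfFormula.disj (ι := {N : K.Node κ (n + 1) // Node.Below K n M N}) (fun N =>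
      InfFormula.ex (β := Block κ)
        (InfFormula.and ((φ N.1).relabel (nextVar κ n))
          (InfFormula.conj (ι := Block κ) (fun a =>
            InfFormula.disj (ι := Idx κ (n + 1)) (fun d =>
              InfFormula.varEq (Sum.inl (Sum.inr a)) (nextVar κ n d)))))))

/-- The canonical formulas `φ_{M,γ,n}(x̄_n)`, by recursion on the ordinal `γ`; at limit ordinals one
takes the conjunction of all earlier formulas. -/
noncomputable def phi (κ : Cardinal.{u}) (γ : Ordinal.{u}) :
    (n : ℕ) → K.Node κ n → InfFormula τ (Idx κ n) :=
  Ordinal.limitRecOn (motive := fun _ => (n : ℕ) → K.Node κ n → InfFormula τ (Idx κ n)) γ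
    (K.phiZero κ)
    (fun _ φ n M => K.phiSucc κ n (φ (n + 1)) M)
    (fun γ _ φ n M => InfFormula.conj (ι := Shrink.{u} (Set.Iio γ)) (fun i =>
      φ ((equivShrink (Set.Iio γ)).symm i).1 ((equivShrink (Set.Iio γ)).symm i).2 n M))

/-- The canonical sentence `φ_{γ,0}`. -/
noncomputable def canonicalSentence (κ : Cardinal.{u}) (γ : Ordinal.{u}) : InfSentence τ :=
  (K.phi κ γ 0 (K.emptyNode κ)).relabel (fun x => x.1.elim0)

end AEC

/-- The cardinal `ℶ₂(κ)⁺⁺`, where `ℶ₂(κ) = 2 ^ (2 ^ κ)`. -/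
noncomputable def bethTwoSuccSucc (κ : Cardinal.{u}) : Cardinal.{u} :=
  Order.succ (Order.succ ((2 : Cardinal.{u}) ^ ((2 : Cardinal.{u}) ^ κ)))

end AECDef

/-! A successor stage of the canonical formulas is one round of a game: a challenge `z̄` of at most
`κ` elements is answered by a node of the next level that lies above the current one and covers
`z̄`. In a member of the class with more than `κ` elements, the Löwenheim–Skolem–Tarski property
allows every answer to be a strongly embedded node. This invariant survives any number of stages, so
all canonical sentences hold (`StrongAt.sat`). Conversely, let `M` satisfy the sentence of stage
`lam + 1`, and consider the images in `M` of the level-1 nodes satisfying stage `lam`. They have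
size at most `κ`, and every set of at most `κ` elements lies in one of them. The crux is that
inclusions between them are strong (`strongLE_of_sat`). Code such an inclusion by its pair type: two
nodes and the index map between them. Each level has at most `2 ^ κ` pair types, and `lam` is
regular and larger than `2 ^ κ`. Hence a type realized at all stages below `lam` extends to a type
of the next level with the same property, whose first model contains the old second model. Iterating
`ω` times gives two interleaved strong chains with a common union. Both initial models are strong in
that union, so coherence makes the first strong in the second (`isStrong_of_interleaved`). The chain
axioms extend to directed systems indexed by finite sets, and such a system can be chosen among
these images with union `M`; so `M` is a member (`mem_of_covering`). The diagrams of level 2 force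
`M` to have more than `κ` elements. The members of size at most `κ` have at most `2 ^ κ` isomorphism
types; adding their descriptions as disjuncts axiomatizes the whole class. -/

namespace AECDef

open FirstOrder Cardinal Language

namespace AEC

variable {τ : FirstOrder.Language.{u, u}} (K : AEC τ)

/-! ### Strong embeddings -/

/-- An embedding is strong if its range is a strong substructure. -/
def IsStrong {A B : Type u} [τ.Structure A] [τ.Structure B] (f : A ↪[τ] B) : Prop :=
  K.Strong f.toHom.range

section StrongEmbeddings

variable {K} {A A' B C : Type u} [τ.Structure A] [τ.Structure A'] [τ.Structure B] [τ.Structure C]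

theorem isStrong_subtype {S : τ.Substructure A} : K.IsStrong S.subtype ↔ K.Strong S := by
  rw [IsStrong, Substructure.range_subtype]

theorem IsStrong.of_range_eq {f : A ↪[τ] B} {g : A' ↪[τ] B} (hf : K.IsStrong f)
    (h : Set.range f = Set.range g) : K.IsStrong g := by
  have : f.toHom.range = g.toHom.range := SetLike.coe_injective h
  rwa [IsStrong, ← this]

theorem IsStrong.mem_left {f : A ↪[τ] B} (hf : K.IsStrong f) : K.Mem A :=
  K.mem_of_equiv f.equivRange.symm (K.mem_left _ hf)

theorem IsStrong.mem_right {f : A ↪[τ] B} (hf : K.IsStrong f) : K.Mem B :=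
  K.mem_right _ hf

theorem IsStrong.equiv_comp {f : A ↪[τ] B} (hf : K.IsStrong f) (e : B ≃[τ] C) :
    K.IsStrong (e.toEmbedding.comp f) := by
  have h := K.strong_of_equiv e _ hf
  have : (e.toEmbedding.comp f).toHom.range = f.toHom.range.map e.toHom :=
    Hom.range_comp f.toHom e.toHom
  rwa [IsStrong, this]

/-- If `g` embeds `B` and `g ∘ f` is an embedding then `S ≺ T` for the ranges `S` and `T` of `g ∘ f`
and `g` amounts to `f` being strong. -/
theorem strong_comap_range_iff (f : A ↪[τ] B) (g : B ↪[τ] C) :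
    K.Strong ((g.comp f).toHom.range.comap g.toHom.range.subtype.toHom) ↔ K.IsStrong f := by
  have key : (g.comp f).toHom.range.comap g.toHom.range.subtype.toHom =
      (g.equivRange.toEmbedding.comp f).toHom.range := by
    ext ⟨x, y, hy⟩
    subst hy
    simp only [Substructure.mem_comap, Hom.mem_range]
    constructor
    · rintro ⟨a, ha⟩
      exact ⟨a, Subtype.ext ha⟩
    · rintro ⟨a, ha⟩
      exact ⟨a, congrArg Subtype.val ha⟩
  rw [key]
  refine ⟨fun h => ?_, fun h => h.equiv_comp _⟩
  have h2 := IsStrong.equiv_comp (f := g.equivRange.toEmbedding.comp f) h g.equivRange.symm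
  refine h2.of_range_eq (congrArg Set.range (funext fun x => ?_))
  simp

theorem IsStrong.comp {g : B ↪[τ] C} {f : A ↪[τ] B} (hg : K.IsStrong g) (hf : K.IsStrong f) :
    K.IsStrong (g.comp f) :=
  K.strong_trans _ g.toHom.range (Hom.range_comp_le_range f.toHom g.toHom)
    ((strong_comap_range_iff f g).2 hf) hg

/-- This is coherence in the language of embeddings. It is what finally extracts strength from a
common extension. -/
theorem IsStrong.of_comp {g : B ↪[τ] C} {f : A ↪[τ] B} (h : K.IsStrong (g.comp f))
    (hg : K.IsStrong g) : K.IsStrong f :=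
  (strong_comap_range_iff f g).1
    (K.coherence _ _ (Hom.range_comp_le_range f.toHom g.toHom) h hg)

theorem isStrong_equiv (hA : K.Mem A) (e : A ≃[τ] B) : K.IsStrong e.toEmbedding := by
  have h := K.strong_refl (K.mem_of_equiv e hA)
  rwa [← Equiv.toHom_range e] at h

theorem strong_comap_subtype_iff {S T : τ.Substructure A} (h : S ≤ T) :
    K.Strong (S.comap T.subtype.toHom) ↔ K.IsStrong (Substructure.inclusion h) := by
  rw [← strong_comap_range_iff (Substructure.inclusion h) T.subtype]
  rw [Substructure.subtype_comp_inclusion, Substructure.range_subtype, Substructure.range_subtype]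

theorem IsStrong.comp_equiv_iff (f : A ↪[τ] B) (e : A' ≃[τ] A) :
    K.IsStrong (f.comp e.toEmbedding) ↔ K.IsStrong f := by
  have h : Set.range (f.comp e.toEmbedding) = Set.range f :=
    e.surjective.range_comp f
  exact ⟨fun h' => h'.of_range_eq h, fun h' => h'.of_range_eq h.symm⟩

/-- Chains of strong inclusions with union `U ≤ M`, relativized to the substructure `U`. -/
theorem strong_inclusion_iUnion {M : Type u} [τ.Structure M] {ι : Type u} [LinearOrder ι]
    [WellFoundedLT ι] [Nonempty ι] (S : ι → τ.Substructure M)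
    (hS : ∀ i j, i ≤ j → ∃ h : S i ≤ S j, K.IsStrong (Substructure.inclusion h))
    (U : τ.Substructure M) (hU : (U : Set M) = ⋃ i, (S i : Set M)) (i : ι) :
    ∃ h : S i ≤ U, K.IsStrong (Substructure.inclusion h) := by
  have hle : ∀ i, S i ≤ U := fun i => by
    rw [← SetLike.coe_subset_coe, hU]
    exact Set.subset_iUnion (fun i => (S i : Set M)) i
  refine ⟨hle i, (strong_comap_subtype_iff (hle i)).1 ?_⟩
  refine (K.union_chain (M := U) (fun i => (S i).comap U.subtype.toHom) ?_ ?_ ?_).2 i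
  · intro i j hij x hx
    exact (hS i j hij).1 hx
  · intro i j hij
    obtain ⟨h, hs⟩ := hS i j hij
    have hm : (S i).comap U.subtype.toHom ≤ (S j).comap U.subtype.toHom := fun x hx => h hx
    rw [strong_comap_subtype_iff hm]
    have hr : ∀ k, (Substructure.inclusion (hle k)).toHom.range = (S k).comap U.subtype.toHom := by
      intro k
      ext x
      simp only [Hom.mem_range, Substructure.mem_comap]
      exact ⟨fun ⟨y, hy⟩ => hy ▸ y.2, fun hx => ⟨⟨x, hx⟩, rfl⟩⟩
    rw [← strong_comap_subtype_iff hm, ← hr i, ← hr j]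
    exact (strong_comap_range_iff (Substructure.inclusion h) (Substructure.inclusion (hle j))).2 hs
  · ext x
    have := x.2
    rw [← SetLike.mem_coe, hU] at this
    simpa using this

/-- The chain is pulled back to `N` and smoothness is applied there. The ambient `M` need not belong
to the class, so strength must be measured inside `N`. -/
theorem inclusion_smoothness {M : Type u} [τ.Structure M] {ι : Type u} [LinearOrder ι]
    [WellFoundedLT ι] [Nonempty ι] (S : ι → τ.Substructure M)
    (hS : ∀ i j, i ≤ j → ∃ h : S i ≤ S j, K.IsStrong (Substructure.inclusion h))
    (U N : τ.Substructure M) (hU : (U : Set M) = ⋃ i, (S i : Set M))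
    (hN : ∀ i, ∃ h : S i ≤ N, K.IsStrong (Substructure.inclusion h)) :
    ∃ h : U ≤ N, K.IsStrong (Substructure.inclusion h) := by
  have hle : ∀ i, S i ≤ N := fun i => (hN i).1
  have hUN : U ≤ N := by
    rw [← SetLike.coe_subset_coe, hU]
    exact Set.iUnion_subset fun i => hle i
  refine ⟨hUN, (strong_comap_subtype_iff hUN).1 ?_⟩
  refine K.smoothness (N := N) (fun i => (S i).comap N.subtype.toHom) ?_ ?_ ?_ _ ?_
  · intro i j hij x hx
    exact (hS i j hij).1 hx
  · intro i j hij
    obtain ⟨h, hs⟩ := hS i j hij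
    have hm : (S i).comap N.subtype.toHom ≤ (S j).comap N.subtype.toHom := fun x hx => h hx
    have hr : ∀ k, (Substructure.inclusion (hle k)).toHom.range = (S k).comap N.subtype.toHom := by
      intro k
      ext x
      simp only [Hom.mem_range, Substructure.mem_comap]
      exact ⟨fun ⟨y, hy⟩ => hy ▸ y.2, fun hx => ⟨⟨x, hx⟩, rfl⟩⟩
    rw [← hr i, ← hr j]
    exact (strong_comap_range_iff (Substructure.inclusion h) (Substructure.inclusion (hle j))).2 hs
  · intro i
    exact (strong_comap_subtype_iff (hle i)).2 (hN i).2
  · ext x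
    have : (x : M) ∈ (U : Set M) ↔ (x : M) ∈ ⋃ i, (S i : Set M) := by rw [hU]
    simpa using this

end StrongEmbeddings

end AEC

namespace AEC

variable {τ : FirstOrder.Language.{u, u}} {K : AEC τ}

/-! ### Directed unions -/

section DirectedUnion

variable {M X : Type u} [τ.Structure M] (g : Finset X → τ.Substructure M)

/-- The union of the substructures `g F` over the finite subsets `F` of `Y`. -/
def unionOver (hg : Monotone g) (Y : Set X) : τ.Substructure M where
  carrier := ⋃ F : {F : Finset X // (F : Set X) ⊆ Y}, (g F.1 : Set M)
  fun_mem {n} f v hv := by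
    classical
    simp only [Set.mem_iUnion] at hv ⊢
    choose F hF using hv
    refine ⟨⟨Finset.univ.biUnion fun i => (F i).1, ?_⟩, ?_⟩
    · intro x hx
      simp only [Finset.coe_biUnion, Set.mem_iUnion] at hx
      obtain ⟨i, -, hx⟩ := hx
      exact (F i).2 hx
    · exact (g _).fun_mem f v fun i =>
        hg (Finset.subset_biUnion_of_mem (fun i => (F i).1) (Finset.mem_univ i)) (hF i)

variable {g}

theorem coe_unionOver (hg : Monotone g) (Y : Set X) :
    (unionOver g hg Y : Set M) = ⋃ F : {F : Finset X // (F : Set X) ⊆ Y}, (g F.1 : Set M) := rfl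

theorem mem_unionOver (hg : Monotone g) {Y : Set X} {x : M} :
    x ∈ unionOver g hg Y ↔ ∃ F : Finset X, (F : Set X) ⊆ Y ∧ x ∈ g F := by
  rw [← SetLike.mem_coe, coe_unionOver]
  simp

/-- `S ≤ T` and the inclusion is strong. -/
def StrongLE (K : AEC τ) (S T : τ.Substructure M) : Prop :=
  ∃ h : S ≤ T, K.IsStrong (Substructure.inclusion h)

theorem StrongLE.trans {S T U : τ.Substructure M} (h₁ : StrongLE K S T) (h₂ : StrongLE K T U) :
    StrongLE K S U :=
  ⟨h₁.1.trans h₂.1, h₂.2.comp h₁.2⟩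

/-- The finite subsets of an infinite set are contained in the members of a chain of sets of
smaller cardinality. -/
theorem exists_chain_of_infinite (Y : Set X) (hY : Y.Infinite) :
    ∃ (ι : Type u) (_ : LinearOrder ι) (_ : WellFoundedLT ι) (_ : Nonempty ι) (Z : ι → Set X),
      Monotone Z ∧ (∀ i, Z i ⊆ Y) ∧ (∀ i, #(Z i) < #Y) ∧
      ∀ F : Finset X, (F : Set X) ⊆ Y → ∃ i, (F : Set X) ⊆ Z i := by
  have hinf : ℵ₀ ≤ #Y := Cardinal.aleph0_le_mk_iff.2 hY.to_subtype
  have e : (#Y).ord.ToType ≃ Y := Classical.choice (Cardinal.eq.1 (by simp))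
  have : NoMaxOrder (#Y).ord.ToType := Cardinal.noMaxOrder hinf
  have : Nonempty (#Y).ord.ToType := e.symm.nonempty_congr.1 hY.nonempty.to_subtype
  refine ⟨(#Y).ord.ToType, inferInstance, inferInstance, inferInstance,
    fun i => (fun j => (e j : X)) '' Set.Iio i, ?_, ?_, ?_, ?_⟩
  · intro i j hij
    exact Set.image_mono (Set.Iio_subset_Iio hij)
  · rintro i _ ⟨j, -, rfl⟩
    exact (e j).2
  · intro i
    refine Cardinal.mk_image_le.trans_lt ?_
    simpa using Cardinal.mk_Iio_lt i
  · intro F hF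
    have hfin : (Set.range fun x : F => e.symm ⟨x.1, hF x.2⟩).Finite := Set.finite_range _
    obtain ⟨b, hb⟩ := hfin.bddAbove
    obtain ⟨c, hc⟩ := exists_gt b
    refine ⟨c, fun x hx => ⟨e.symm ⟨x, hF hx⟩, ?_, by simp⟩⟩
    exact lt_of_le_of_lt (hb ⟨⟨x, hx⟩, rfl⟩) hc

/-- Induction on the cardinality of `Y`. A finite `Y` is its own largest index; an infinite `Y` is
exhausted by an increasing chain of smaller sets. The two halves must be proved together: both are
needed to see that the unions over the smaller sets form a strong chain, to which the chain axioms
apply. -/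
theorem strongLE_unionOver_and_smoothness (hg : Monotone g)
    (hs : ∀ F F' : Finset X, F ⊆ F' → StrongLE K (g F) (g F')) (Y : Set X) :
    (∀ F : Finset X, (F : Set X) ⊆ Y → StrongLE K (g F) (unionOver g hg Y)) ∧
    ∀ N : τ.Substructure M, (∀ F : Finset X, (F : Set X) ⊆ Y → StrongLE K (g F) N) →
      StrongLE K (unionOver g hg Y) N := by
  induction hc : #Y using WellFoundedLT.induction generalizing Y with
  | ind c ih =>
    subst hc
    by_cases hY : Y.Finite
    · obtain ⟨F₀, rfl⟩ := hY.exists_finset_coe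
      have : unionOver g hg (F₀ : Set X) = g F₀ := by
        ext x
        rw [mem_unionOver]
        exact ⟨fun ⟨F, hF, hx⟩ => hg (Finset.coe_subset.1 hF) hx, fun hx => ⟨F₀, subset_rfl, hx⟩⟩
      rw [this]
      exact ⟨fun F hF => hs F F₀ (Finset.coe_subset.1 hF), fun N hN => hN F₀ subset_rfl⟩
    · obtain ⟨ι, _, _, _, Z, hZm, hZY, hZc, hZF⟩ := exists_chain_of_infinite Y hY
      have hchain : ∀ i j, i ≤ j → StrongLE K (unionOver g hg (Z i)) (unionOver g hg (Z j)) :=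
        fun i j hij => (ih _ (hZc i) (Z i) rfl).2 _ fun F hF =>
          (ih _ (hZc j) (Z j) rfl).1 F (hF.trans (hZm hij))
      have hU : (unionOver g hg Y : Set M) = ⋃ i, (unionOver g hg (Z i) : Set M) := by
        ext x
        simp only [SetLike.mem_coe, Set.mem_iUnion, mem_unionOver]
        constructor
        · rintro ⟨F, hF, hx⟩
          obtain ⟨i, hi⟩ := hZF F hF
          exact ⟨i, F, hi, hx⟩
        · rintro ⟨i, F, hF, hx⟩
          exact ⟨F, hF.trans (hZY i), hx⟩
      refine ⟨fun F hF => ?_, fun N hN => ?_⟩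
      · obtain ⟨i, hi⟩ := hZF F hF
        exact ((ih _ (hZc i) (Z i) rfl).1 F hi).trans (strong_inclusion_iUnion _ hchain _ hU i)
      · exact inclusion_smoothness _ hchain _ N hU fun i =>
          (ih _ (hZc i) (Z i) rfl).2 N fun F hF => hN F (hF.trans (hZY i))

/-- A structure which is the union of a system of substructures indexed by finite sets, directed
with respect to strong inclusion, belongs to the class. -/
theorem mem_of_finset_system (hs : ∀ F F' : Finset X, F ⊆ F' → StrongLE K (g F) (g F'))
    (hU : ∀ x, ∃ F, x ∈ g F) : K.Mem M := by
  have hg : Monotone g := fun F F' h => (hs F F' h).1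
  have h := ((strongLE_unionOver_and_smoothness hg hs Set.univ).1 ∅ (by simp)).2.mem_right
  have htop : unionOver g hg Set.univ = ⊤ := by
    ext x
    simpa [mem_unionOver] using hU x
  rw [htop] at h
  exact K.mem_of_equiv Substructure.topEquiv h

/-- If a family of substructures is such that every subset of cardinality at most `κ` is contained
in a member, members have cardinality at most `κ`, and inclusions between members are strong, then
the structure belongs to the class. -/
theorem mem_of_covering {κ : Cardinal.{u}} (hκ : ℵ₀ ≤ κ) (D : Set (τ.Substructure M))
    (hcard : ∀ S ∈ D, #S ≤ κ) (hcov : ∀ A : Set M, #A ≤ κ → ∃ S ∈ D, A ⊆ S)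
    (hstrong : ∀ S ∈ D, ∀ T ∈ D, S ≤ T → StrongLE K S T) : K.Mem M := by
  classical
  -- Recursion step along `⊂`: a finite set has finitely many proper subsets, so the members already
  -- chosen for them, together with `F`, still form a set of size at most `κ`.
  have step : ∀ (F : Finset M) (r : ∀ F' : Finset M, F' ⊂ F → D), ∃ S : D,
      (F : Set M) ⊆ S.1 ∧ ∀ F' h, (r F' h).1 ≤ S.1 := by
    intro F r
    have hfin : Finite {F' : Finset M // F' ⊂ F} :=
      Set.Finite.to_subtype (F.powerset.finite_toSet.subset fun F' (h : F' ⊂ F) => by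
        simpa using h.1)
    have hA : #((F : Set M) ∪ ⋃ p : {F' : Finset M // F' ⊂ F}, ((r p.1 p.2).1 : Set M) : Set M)
        ≤ κ := by
      refine (Cardinal.mk_union_le _ _).trans (Cardinal.add_le_of_le hκ ?_ ?_)
      · exact (Cardinal.lt_aleph0_of_finite _).le.trans hκ
      · refine (Cardinal.mk_iUnion_le _).trans ?_
        refine Cardinal.mul_le_of_le hκ ((Cardinal.lt_aleph0_of_finite _).le.trans hκ) ?_
        exact ciSup_le' fun p => hcard _ (r p.1 p.2).2
    obtain ⟨S, hS, hAS⟩ := hcov _ hA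
    refine ⟨⟨S, hS⟩, Set.subset_union_left.trans hAS, fun F' h => ?_⟩
    exact (Set.subset_iUnion (fun p : {F' : Finset M // F' ⊂ F} => ((r p.1 p.2).1 : Set M))
      ⟨F', h⟩).trans (Set.subset_union_right.trans hAS)
  choose s hs₁ hs₂ using step
  let wf : WellFounded ((· ⊂ ·) : Finset M → Finset M → Prop) := wellFounded_lt
  let g : Finset M → D := wf.fix s
  have hgF : ∀ F, g F = s F fun F' _ => g F' := fun F => wf.fix_eq s F
  refine mem_of_finset_system (X := M) (g := fun F => (g F).1) ?_ ?_
  · intro F F' h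
    refine hstrong _ (g F).2 _ (g F').2 ?_
    rcases h.eq_or_ssubset with rfl | h'
    · exact le_rfl
    · rw [hgF F']
      exact hs₂ F' (fun F' _ => g F') F h'
  · intro x
    refine ⟨{x}, ?_⟩
    rw [hgF]
    exact hs₁ {x} _ (by simp)

end DirectedUnion

end AEC

/-! ### Satisfaction of the canonical formulas -/

section Relabel

variable {τ : FirstOrder.Language.{u, u}} {M : Type u} [τ.Structure M]

theorem AtomicFormula.realize_relabel {α β : Type u} (g : α → β) (a : AtomicFormula τ α)
    (v : β → M) : (a.relabel g).Realize v ↔ a.Realize (v ∘ g) := by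
  cases a <;> simp [AtomicFormula.relabel, AtomicFormula.Realize]

theorem InfFormula.realize_relabel {α : Type u} (φ : InfFormula τ α) :
    ∀ {β : Type u} (g : α → β) (v : β → M), (φ.relabel g).Realize v ↔ φ.Realize (v ∘ g) := by
  have hsum : ∀ {α β γ : Type u} (g : α → β) (v : β → M) (w : γ → M),
      Sum.elim v w ∘ Sum.map g id = Sum.elim (v ∘ g) w := by
    intro α β γ g v w
    ext (x | x) <;> rfl
  induction φ with
  | atom a => exact fun g v => a.realize_relabel g v
  | not φ ih => exact fun g v => not_congr (ih g v)
  | conj φ ih => exact fun g v => forall_congr' fun i => ih i g v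
  | disj φ ih => exact fun g v => exists_congr fun i => ih i g v
  | all φ ih =>
    intro β' g v
    refine forall_congr' fun w => ?_
    rw [ih, hsum]
  | ex φ ih =>
    intro β' g v
    refine exists_congr fun w => ?_
    rw [ih, hsum]

theorem InfFormula.inLogic_relabel {μ θ : Cardinal.{u}} {α : Type u} (φ : InfFormula τ α) :
    ∀ {β : Type u} (g : α → β), φ.InLogic μ θ → (φ.relabel g).InLogic μ θ := by
  induction φ with
  | atom a => exact fun g h => h
  | not φ ih => exact fun g h => ih g h
  | conj φ ih => exact fun g h => ⟨h.1, fun i => ih i g (h.2 i)⟩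
  | disj φ ih => exact fun g h => ⟨h.1, fun i => ih i g (h.2 i)⟩
  | all φ ih => exact fun g h => ⟨h.1, ih _ h.2⟩
  | ex φ ih => exact fun g h => ⟨h.1, ih _ h.2⟩

theorem InfFormula.realize_and {α : Type u} (φ ψ : InfFormula τ α) (v : α → M) :
    (φ.and ψ).Realize v ↔ φ.Realize v ∧ ψ.Realize v := by
  constructor
  · exact fun h => ⟨h ⟨true⟩, h ⟨false⟩⟩
  · rintro ⟨h₁, h₂⟩ ⟨_ | _⟩
    exacts [h₂, h₁]

theorem InfFormula.realize_varEq {α : Type u} (x y : α) (v : α → M) :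
    (InfFormula.varEq (τ := τ) x y).Realize v ↔ v x = v y := Iff.rfl

theorem AtomicFormula.realize_embedding {α : Type u} {N : Type u} [τ.Structure N] (f : N ↪[τ] M)
    (a : AtomicFormula τ α) (v : α → N) : a.Realize (f ∘ v) ↔ a.Realize v := by
  cases a with
  | equal t₁ t₂ =>
    simp only [AtomicFormula.Realize, HomClass.realize_term]
    exact f.injective.eq_iff
  | rel R ts =>
    simp only [AtomicFormula.Realize, HomClass.realize_term]
    exact f.map_rel R _

/-- Every element of the structure is named by a variable, so the formulas `x = y`, `x = F(ȳ)` and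
`R(x̄)` already force `v` to be an embedding. -/
theorem AEC.realize_diagram {α : Type u} (s : τ.Structure α) (v : α → M) :
    (AEC.diagram s).Realize v ↔ ∃ f : α ↪[τ] M, ⇑f = v := by
  have key : (AEC.diagram s).Realize v ↔
      ∀ a : AtomicFormula τ α, a.Realize v ↔ a.Realize (id : α → α) := by
    constructor
    · intro h a
      by_cases ha : a.Realize (id : α → α)
      · have := h ⟨(a, true), by simpa using ha⟩
        exact ⟨fun _ => ha, fun _ => this⟩
      · have := h ⟨(a, false), by simpa using ha⟩
        exact ⟨fun h' => absurd h' this, fun h' => absurd h' ha⟩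
    · rintro h ⟨⟨a, _ | _⟩, ha⟩
      · exact fun h' => by simpa using ha.2 ((h a).1 h')
      · exact (h a).2 (ha.1 rfl)
  rw [key]
  constructor
  · intro h
    refine ⟨{ toFun := v, inj' := ?_, map_fun' := ?_, map_rel' := ?_ }, rfl⟩
    · intro x y hxy
      exact (h (.equal (.var x) (.var y))).1 hxy
    · intro n F x
      exact (h (.equal (.var (Structure.funMap F x)) (.func F fun i => .var (x i)))).2 rfl
    · intro n R x
      exact h (.rel R fun i => .var (x i))
  · rintro ⟨f, rfl⟩ a
    exact a.realize_embedding f id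

end Relabel

namespace AEC

variable {τ : FirstOrder.Language.{u, u}} {K : AEC τ} {κ : Cardinal.{u}} {M : Type u}

/-- The concatenation of the assignments `v` to `x̄_n` and `w` to the next block of variables. -/
def append {n : ℕ} (v : Idx κ n → M) (w : Block κ → M) (x : Idx κ (n + 1)) : M :=
  if h : (x.1 : ℕ) < n then v (⟨x.1, h⟩, x.2) else w x.2

/-- The inclusion of the indices of level `n` into those of level `n + 1`. -/
def inc {n : ℕ} (x : Idx κ n) : Idx κ (n + 1) := (x.1.castSucc, x.2)

theorem append_inc {n : ℕ} (v : Idx κ n → M) (w : Block κ → M) (x : Idx κ n) :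
    append v w (inc x) = v x := by
  simp [append, inc]

theorem append_last {n : ℕ} (v : Idx κ n → M) (w : Block κ → M) (a : Block κ) :
    append v w (Fin.last n, a) = w a := by
  simp [append]

theorem exists_idx_succ {n : ℕ} {p : Idx κ (n + 1) → Prop} :
    (∃ x, p x) ↔ (∃ x, p (inc x)) ∨ ∃ a, p (Fin.last n, a) := by
  constructor
  · rintro ⟨⟨i, a⟩, h⟩
    refine Fin.lastCases (motive := fun i => p (i, a) → _) (fun h => Or.inr ⟨a, h⟩)
      (fun i h => Or.inl ⟨(i, a), h⟩) i h
  · rintro (⟨x, h⟩ | ⟨a, h⟩) <;> exact ⟨_, h⟩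

theorem range_append {n : ℕ} (v : Idx κ n → M) (w : Block κ → M) :
    Set.range (append v w) = Set.range v ∪ Set.range w := by
  ext y
  simp only [Set.mem_range, Set.mem_union]
  rw [exists_idx_succ]
  simp only [append_inc, append_last]

/-! ### Semantics of the canonical formulas, stage by stage -/

variable (K) in
/-- Satisfaction of the canonical formula `φ_{N,γ,n}` at the assignment `v`. -/
def Sat [τ.Structure M] (γ : Ordinal.{u}) (n : ℕ) (N : K.Node κ n) (v : Idx κ n → M) : Prop :=
  (K.phi κ γ n N).Realize v

theorem phi_zero (n : ℕ) (N : K.Node κ n) : K.phi κ 0 n N = K.phiZero κ n N := by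
  rw [phi, Ordinal.limitRecOn_zero]

theorem phi_succ (γ : Ordinal.{u}) (n : ℕ) (N : K.Node κ n) :
    K.phi κ (γ + 1) n N = K.phiSucc κ n (K.phi κ γ (n + 1)) N := by
  unfold phi
  rw [Ordinal.limitRecOn_add_one]

theorem phi_limit {γ : Ordinal.{u}} (hγ : Order.IsSuccLimit γ) (n : ℕ) (N : K.Node κ n) :
    K.phi κ γ n N = InfFormula.conj (ι := Shrink.{u} (Set.Iio γ)) fun i =>
      K.phi κ ((equivShrink (Set.Iio γ)).symm i).1 n N := by
  unfold phi
  rw [Ordinal.limitRecOn_limit _ _ _ _ hγ]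

variable [τ.Structure M]

theorem sat_zero_succ {n : ℕ} (N : K.Node κ (n + 1)) (v : Idx κ (n + 1) → M) :
    Sat K 0 (n + 1) N v ↔
      letI : τ.Structure (Idx κ (n + 1)) := N.1
      ∃ f : Idx κ (n + 1) ↪[τ] M, ⇑f = v := by
  rw [Sat, phi_zero]
  exact realize_diagram N.1 v

theorem sat_limit {γ : Ordinal.{u}} (hγ : Order.IsSuccLimit γ) {n : ℕ} (N : K.Node κ n)
    (v : Idx κ n → M) : Sat K γ n N v ↔ ∀ β < γ, Sat K β n N v := by
  rw [Sat, phi_limit hγ]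
  constructor
  · intro h β hβ
    have := h (equivShrink (Set.Iio γ) ⟨β, hβ⟩)
    beta_reduce at this
    rwa [Equiv.symm_apply_apply] at this
  · exact fun h i => h _ ((equivShrink (Set.Iio γ)).symm i).2

theorem sat_succ (γ : Ordinal.{u}) {n : ℕ} (N : K.Node κ n) (v : Idx κ n → M) :
    Sat K (γ + 1) n N v ↔ ∀ z : Block κ → M, ∃ N' : K.Node κ (n + 1),
      Node.Below K n N N' ∧ ∃ w : Block κ → M, Sat K γ (n + 1) N' (append v w) ∧
        Set.range z ⊆ Set.range (append v w) := by
  have hvar : ∀ (z w : Block κ → M),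
      Sum.elim (Sum.elim v z) w ∘ nextVar κ n = append v w := by
    intro z w
    ext x
    simp only [Function.comp_apply, nextVar, append]
    split <;> rfl
  have hvar' : ∀ (z w : Block κ → M) d,
      Sum.elim (Sum.elim v z) w (nextVar κ n d) = append v w d := fun z w d =>
    congrFun (hvar z w) d
  rw [Sat, phi_succ]
  simp only [phiSucc, InfFormula.Realize, InfFormula.realize_and, InfFormula.realize_relabel,
    InfFormula.realize_varEq, hvar, hvar', Sum.elim_inl, Sum.elim_inr, Subtype.exists]
  refine forall_congr' fun z => exists_congr fun N' => ?_
  rw [exists_prop]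
  refine and_congr_right fun _ => exists_congr fun w => and_congr_right fun _ => ?_
  rw [Set.range_subset_iff]
  exact forall_congr' fun a => exists_congr fun d => eq_comm

theorem Sat.succ_mono {γ δ : Ordinal.{u}} {n : ℕ} {N : K.Node κ n} {v : Idx κ n → M}
    (h : Sat K (γ + 1) n N v)
    (hγδ : ∀ (N' : K.Node κ (n + 1)) (v' : Idx κ (n + 1) → M),
      Sat K γ (n + 1) N' v' → Sat K δ (n + 1) N' v') : Sat K (δ + 1) n N v := by
  rw [sat_succ] at h ⊢
  intro z
  obtain ⟨N', hN', w, hw, hz⟩ := h z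
  exact ⟨N', hN', w, hγδ _ _ hw, hz⟩

/-- Some challenge is needed to obtain an answer, whence `Nonempty M`. The diagram of the answer
restricts to that of `N`. -/
theorem sat_zero_of_sat_one [Nonempty M] {n : ℕ} {N : K.Node κ n} {v : Idx κ n → M}
    (h : Sat K (0 + 1) n N v) : Sat K 0 n N v := by
  cases n with
  | zero =>
    rw [Sat, phi_zero]
    rintro ⟨⟩
  | succ n =>
    rw [sat_succ] at h
    obtain ⟨N', hN', w, hw, -⟩ := h fun _ => Classical.arbitrary M
    rw [sat_zero_succ] at hw ⊢
    let _ : τ.Structure (Idx κ (n + 1)) := N.1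
    let _ : τ.Structure (Idx κ (n + 2)) := N'.1
    obtain ⟨f, hf, -⟩ := hN'
    obtain ⟨e, he⟩ := hw
    refine ⟨e.comp f, funext fun x => ?_⟩
    rw [Embedding.comp_apply, hf, he]
    exact append_inc v w x

/-- Only limit stages contain the earlier formulas syntactically. The passage from `γ + 1` to `γ` is
a separate induction, taken over all levels at once because a successor stage refers to the next
level. -/
theorem Sat.mono [Nonempty M] {γ β : Ordinal.{u}} (hβ : β ≤ γ) {n : ℕ} {N : K.Node κ n}
    {v : Idx κ n → M} (h : Sat K γ n N v) : Sat K β n N v := by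
  have step : ∀ γ : Ordinal.{u}, ∀ (n : ℕ) (N : K.Node κ n) (v : Idx κ n → M),
      Sat K (γ + 1) n N v → Sat K γ n N v := by
    intro γ
    induction γ using Ordinal.limitRecOn with
    | zero => exact fun n N v h => sat_zero_of_sat_one h
    | add_one γ ih => exact fun n N v h => h.succ_mono (ih _)
    | limit γ hγ ih =>
      intro n N v h
      rw [sat_limit hγ]
      exact fun β hβ => ih β hβ n N v (h.succ_mono fun N' v' h' => (sat_limit hγ N' v').1 h' β hβ)
  induction γ using Ordinal.limitRecOn generalizing β n with
  | zero => rwa [nonpos_iff_eq_zero.1 hβ]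
  | add_one γ ih =>
    rcases hβ.eq_or_lt with rfl | hlt
    · exact h
    · exact ih (Order.lt_add_one_iff.1 hlt) (step _ _ _ _ h)
  | limit γ hγ ih =>
    rcases hβ.eq_or_lt with rfl | hlt
    · exact h
    · exact (sat_limit hγ N v).1 h β hlt

theorem models_canonicalSentence (γ : Ordinal.{u}) (v : Idx κ 0 → M) :
    Models M (K.canonicalSentence κ γ) ↔ Sat K γ 0 (K.emptyNode κ) v := by
  rw [Models, canonicalSentence, InfFormula.realize_relabel, Sat,
    Subsingleton.elim v]

end AEC

namespace AEC

variable {τ : FirstOrder.Language.{u, u}} {K : AEC τ} {κ : Cardinal.{u}}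

/-! ### Interleaved chains -/

theorem isStrong_of_nat_chain {A : ℕ → Type u} [∀ n, τ.Structure (A n)] {W : Type u}
    [τ.Structure W] (a : ∀ n, A n ↪[τ] A (n + 1)) (ha : ∀ n, K.IsStrong (a n))
    (c : ∀ n, A n ↪[τ] W) (hc : ∀ n, (c (n + 1)).comp (a n) = c n)
    (hW : ∀ w, ∃ n x, c n x = w) (n : ℕ) : K.IsStrong (c n) := by
  have hij : ∀ i j, i ≤ j → ∃ f : A i ↪[τ] A j, K.IsStrong f ∧ (c j).comp f = c i := by
    intro i j h
    induction j, h using Nat.le_induction with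
    | base =>
      exact ⟨Embedding.refl τ _, isStrong_equiv (ha i).mem_left (Language.Equiv.refl τ (A i)), rfl⟩
    | succ j _ ih =>
      obtain ⟨f, hf, hcf⟩ := ih
      exact ⟨(a j).comp f, (ha j).comp hf, by rw [← Embedding.comp_assoc, hc, hcf]⟩
  have : WellFoundedLT (ULift.{u} ℕ) := ⟨InvImage.wf ULift.down wellFounded_lt⟩
  refine (K.union_chain (ι := ULift.{u} ℕ) (fun i => (c i.down).toHom.range) ?_ ?_ ?_).2 ⟨n⟩
  · intro i j h
    obtain ⟨f, -, hf⟩ := hij i.down j.down h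
    simp only [← hf]
    exact Hom.range_comp_le_range f.toHom (c j.down).toHom
  · intro i j h
    obtain ⟨f, hf, hcf⟩ := hij i.down j.down h
    simp only [← hcf]
    exact (strong_comap_range_iff f (c j.down)).2 hf
  · rw [Set.eq_univ_iff_forall]
    intro w
    obtain ⟨n, x, rfl⟩ := hW w
    exact Set.mem_iUnion.2 ⟨⟨n⟩, x, rfl⟩

/-- If two strong chains `A` and `B` of order type `ω` are interleaved, with respect to embeddings
`e n` of `A n` into `B n`, then `e 0` is strong: it is a factor of the strong embedding of `A 0` into
the common union of the chains. -/
theorem isStrong_of_interleaved {A B : ℕ → Type u} [∀ n, τ.Structure (A n)]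
    [∀ n, τ.Structure (B n)] (a : ∀ n, A n ↪[τ] A (n + 1)) (ha : ∀ n, K.IsStrong (a n))
    (b : ∀ n, B n ↪[τ] B (n + 1)) (hb : ∀ n, K.IsStrong (b n)) (e : ∀ n, A n ↪[τ] B n)
    (hcomm : ∀ n, (e (n + 1)).comp (a n) = (b n).comp (e n))
    (hsurj : ∀ n y, ∃ x, e (n + 1) x = b n y) : K.IsStrong (e 0) := by
  -- The common union is the direct limit of `B`; by `hsurj` the images of the `A n` exhaust it as
  -- well.
  let c := DirectLimit.of τ ℕ B (DirectedSystem.natLERec b)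
  have hc : ∀ n, (c (n + 1)).comp (b n) = c n := by
    intro n
    ext x
    have h := DirectLimit.of_f (L := τ) (f := DirectedSystem.natLERec b)
      (hij := Nat.le_succ n) (x := x)
    rw [DirectedSystem.coe_natLERec] at h
    simp only [Nat.leRecOn_succ'] at h
    exact h
  have hW : ∀ w, ∃ n x, c n x = w := DirectLimit.exists_of (L := τ)
  have hB : K.IsStrong (c 0) := isStrong_of_nat_chain b hb c hc hW 0
  have hA : K.IsStrong ((c 0).comp (e 0)) := by
    refine isStrong_of_nat_chain a ha (fun n => (c n).comp (e n)) ?_ ?_ 0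
    · intro n
      rw [Embedding.comp_assoc, hcomm, ← Embedding.comp_assoc, hc]
    · intro w
      obtain ⟨n, y, rfl⟩ := hW w
      obtain ⟨x, hx⟩ := hsurj n y
      refine ⟨n + 1, x, ?_⟩
      rw [Embedding.comp_apply, hx, ← Embedding.comp_apply, hc]
  exact hA.of_comp hB

/-! ### Models satisfying the canonical formulas -/

/-- The underlying model of a node of positive level. -/
def Carrier {n : ℕ} (_ : K.Node κ (n + 1)) : Type u := Idx κ (n + 1)

instance {n : ℕ} (N : K.Node κ (n + 1)) : τ.Structure (Carrier N) := N.1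

/-- The identification of the indices of level `n + 1` with the elements of a model of this level. -/
def toCarrier {n : ℕ} (N : K.Node κ (n + 1)) : Idx κ (n + 1) ≃ Carrier N := Equiv.refl _

theorem below_succ_iff {n : ℕ} {N : K.Node κ (n + 1)} {N' : K.Node κ (n + 2)} :
    Node.Below K (n + 1) N N' ↔
      ∃ f : Carrier N ↪[τ] Carrier N', (∀ x, f (toCarrier N x) = toCarrier N' (inc x)) ∧
        K.IsStrong f :=
  Iff.rfl

variable {M : Type u} [τ.Structure M]

theorem exists_embedding_of_sat [Nonempty M] {γ : Ordinal.{u}} {n : ℕ} {N : K.Node κ (n + 1)}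
    {v : Idx κ (n + 1) → M} (h : Sat K γ (n + 1) N v) :
    ∃ f : Carrier N ↪[τ] M, ∀ x, f (toCarrier N x) = v x := by
  obtain ⟨f, hf⟩ := (sat_zero_succ N v).1 (h.mono zero_le)
  exact ⟨f, congrFun hf⟩

theorem exists_subset_range [Nonempty M] (A : Set M) (hA : #A ≤ κ) :
    ∃ z : Block κ → M, A ⊆ Set.range z := by
  have : #A ≤ #(Block κ) := by simpa using hA
  obtain ⟨f⟩ := this
  refine ⟨fun i => Function.extend f Subtype.val (fun _ => Classical.arbitrary M) i, ?_⟩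
  intro x hx
  exact ⟨f ⟨x, hx⟩, f.injective.extend_apply _ _ _⟩

theorem mk_idx_le (hκ : ℵ₀ ≤ κ) (n : ℕ) : #(Idx κ n) ≤ κ := by
  rw [Cardinal.mk_prod]
  simp only [Cardinal.lift_uzero, Cardinal.mk_fin, Cardinal.lift_natCast, Cardinal.mk_ord_toType]
  exact Cardinal.mul_le_of_le hκ ((Cardinal.natCast_lt_aleph0).le.trans hκ) le_rfl

/-! ### Pair types and their extensions along the tree -/

variable (K κ) in
/-- The possible isomorphism types of a pair of models of level `n` of the canonical tree, the first
of which is contained in the second. -/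
abbrev PairType (n : ℕ) : Type u := K.Node κ n × K.Node κ n × (Idx κ n → Idx κ n)

variable (M) in
/-- The pair type is realized in `M` by models satisfying the canonical formulas of stage `β`. -/
def RealizedAt (β : Ordinal.{u}) {n : ℕ} (s : PairType K κ n) : Prop :=
  ∃ v : Idx κ n → M, Sat K β n s.2.1 v ∧ Sat K β n s.1 (v ∘ s.2.2)

/-- The second pair type continues the first, and its first model contains the second model of
the first pair. -/
structure PairType.Extends {n : ℕ} (s : PairType K κ n) (s' : PairType K κ (n + 1)) : Prop where
  below_left : Node.Below K n s.1 s'.1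
  below_right : Node.Below K n s.2.1 s'.2.1
  comm : ∀ x, s'.2.2 (inc x) = inc (s.2.2 x)
  covers : ∀ y, ∃ x, s'.2.2 x = inc y

theorem RealizedAt.mono [Nonempty M] {γ β : Ordinal.{u}} (hβ : β ≤ γ) {n : ℕ} {s : PairType K κ n}
    (h : RealizedAt M γ s) : RealizedAt M β s := by
  obtain ⟨v, h₁, h₂⟩ := h
  exact ⟨v, h₁.mono hβ, h₂.mono hβ⟩

/-- One round is played on each side. The first model is challenged with the range of the second,
which yields `covers`; the second is then challenged with the enlarged first model, which yields the
new index map. -/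
theorem RealizedAt.exists_extends [Nonempty M] (hκ : ℵ₀ ≤ κ) {β : Ordinal.{u}} {n : ℕ}
    {s : PairType K κ n} (h : RealizedAt M (β + 1) s) :
    ∃ s' : PairType K κ (n + 1), s.Extends s' ∧ RealizedAt M β s' := by
  obtain ⟨v, h₂, h₁⟩ := h
  rw [sat_succ] at h₁ h₂
  obtain ⟨z, hz⟩ := exists_subset_range (κ := κ) (Set.range v)
    (Cardinal.mk_range_le.trans (mk_idx_le hκ n))
  obtain ⟨N₁, hN₁, w₁, hw₁, hz₁⟩ := h₁ z
  obtain ⟨z', hz'⟩ := exists_subset_range (κ := κ) (Set.range (append (v ∘ s.2.2) w₁))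
    (Cardinal.mk_range_le.trans (mk_idx_le hκ (n + 1)))
  obtain ⟨N₂, hN₂, w₂, hw₂, hz₂⟩ := h₂ z'
  have hr : ∀ a, ∃ y, append v w₂ y = w₁ a := fun a =>
    hz₂ (hz' ⟨(Fin.last n, a), append_last _ _ a⟩)
  choose r hr using hr
  -- The new index map continues the old one and sends the new block to positions of its elements in
  -- the second model.
  have he : append v w₂ ∘ append (fun x => inc (s.2.2 x)) r = append (v ∘ s.2.2) w₁ := by
    ext x
    simp only [append, Function.comp_apply]
    by_cases h : (x.1 : ℕ) < n
    · simp only [h, dif_pos]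
      exact append_inc v w₂ _
    · simp only [h, dif_neg, not_false_iff]
      exact hr _
  refine ⟨(N₁, N₂, append (fun x => inc (s.2.2 x)) r),
    ⟨hN₁, hN₂, fun x => append_inc (fun x => inc (s.2.2 x)) r x, fun y => ?_⟩,
    append v w₂, hw₂, ?_⟩
  · obtain ⟨x, hx⟩ := hz₁ (hz ⟨y, rfl⟩)
    refine ⟨x, ?_⟩
    obtain ⟨f, hf⟩ := exists_embedding_of_sat hw₂
    apply (toCarrier N₂).injective
    apply f.injective
    rw [hf, hf, append_inc, ← hx, ← he, Function.comp_apply]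
  · simpa only [he] using hw₁

/-- By regularity of `lam`, a pair type which is realized at all stages below `lam` has an extension
with the same property. -/
theorem exists_extends_of_realizedAt [Nonempty M] (hκ : ℵ₀ ≤ κ) {lam : Cardinal.{u}}
    (hreg : lam.IsRegular) {n : ℕ} (hcard : #(PairType K κ (n + 1)) < lam) {s : PairType K κ n}
    (h : ∀ β < lam.ord, RealizedAt M β s) :
    ∃ s' : PairType K κ (n + 1), s.Extends s' ∧ ∀ β < lam.ord, RealizedAt M β s' := by
  by_contra! hcon
  have hb : ∀ s' : PairType K κ (n + 1), ∃ b < lam.ord, s.Extends s' → ¬ RealizedAt M b s' := by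
    intro s'
    by_cases hs : s.Extends s'
    · obtain ⟨b, hb, hb'⟩ := hcon s' hs
      exact ⟨b, hb, fun _ => hb'⟩
    · exact ⟨0, hreg.ord_pos, fun h => absurd h hs⟩
  choose b hb hb' using hb
  -- If every extension failed at some stage, regularity would bound these stages below `lam`. A
  -- realization of `s` one stage above the bound then yields an extension that does not fail at its
  -- own stage.
  have hsup : ⨆ s', b s' < lam.ord := Ordinal.iSup_lt_of_lt_cof (by rwa [hreg.cof_ord]) hb
  obtain ⟨s', hs', hr⟩ :=
    (h _ ((Cardinal.isSuccLimit_ord hreg.aleph0_le).succ_lt hsup)).exists_extends hκ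
  exact hb' s' hs' (hr.mono (Ordinal.le_iSup b s'))

/-- The embedding of the first model into `M` factors through that of the second. The resulting map
depends only on the pair type, not on the realization. -/
theorem RealizedAt.exists_embedding [Nonempty M] {β : Ordinal.{u}} {n : ℕ}
    {s : PairType K κ (n + 1)} (h : RealizedAt M β s) :
    ∃ e : Carrier s.1 ↪[τ] Carrier s.2.1, ∀ x, e (toCarrier s.1 x) = toCarrier s.2.1 (s.2.2 x) := by
  obtain ⟨v, h₂, h₁⟩ := h
  obtain ⟨f₁, hf₁⟩ := exists_embedding_of_sat h₁
  obtain ⟨f₂, hf₂⟩ := exists_embedding_of_sat h₂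
  let g : Carrier s.1 → Carrier s.2.1 := fun x => toCarrier s.2.1 (s.2.2 ((toCarrier s.1).symm x))
  have hcomp : ∀ x, f₂ (g x) = f₁ x := fun x => by
    obtain ⟨x, rfl⟩ := (toCarrier s.1).surjective x
    rw [hf₁, hf₂, Equiv.symm_apply_apply, Function.comp_apply]
  refine ⟨{ toFun := g, inj' := ?_, map_fun' := ?_, map_rel' := ?_ }, fun x => rfl⟩
  · intro x y hxy
    apply f₁.injective
    rw [← hcomp, ← hcomp]
    exact congrArg f₂ hxy
  · intro m F x
    apply f₂.injective
    rw [hcomp, f₁.map_fun, f₂.map_fun]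
    exact congrArg _ (funext fun i => (hcomp (x i)).symm)
  · intro m R x
    rw [← f₂.map_rel, ← f₁.map_rel]
    exact iff_of_eq (congrArg _ (funext fun i => hcomp (x i)))

/-- An embedding between models of level `1` is strong if its pair type is realized at all stages
below a large regular cardinal. -/
theorem isStrong_of_realizedAt [Nonempty M] (hκ : ℵ₀ ≤ κ) {lam : Cardinal.{u}}
    (hreg : lam.IsRegular) (hcard : ∀ n, #(PairType K κ n) < lam) {s : PairType K κ 1}
    (h : ∀ β < lam.ord, RealizedAt M β s) (e : Carrier s.1 ↪[τ] Carrier s.2.1)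
    (he : ∀ x, e (toCarrier s.1 x) = toCarrier s.2.1 (s.2.2 x)) : K.IsStrong e := by
  choose next hnext hnext' using fun (n : ℕ)
    (s : {s : PairType K κ (n + 1) // ∀ β < lam.ord, RealizedAt M β s}) =>
    exists_extends_of_realizedAt hκ hreg (hcard (n + 2)) s.2
  -- Only the types are iterated. Realizations at successive levels need not cohere, so the two
  -- chains need not embed in `M` as a whole.
  let t : (n : ℕ) → {s : PairType K κ (n + 1) // ∀ β < lam.ord, RealizedAt M β s} :=
    Nat.rec ⟨s, h⟩ fun n s => ⟨next n s, hnext' n s⟩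
  have ht : ∀ n, (t n).1.Extends (t (n + 1)).1 := fun n => hnext n (t n)
  choose a ha ha' using fun n => below_succ_iff.1 (ht n).below_left
  choose b hb hb' using fun n => below_succ_iff.1 (ht n).below_right
  choose c hc using fun n => ((t n).2 0 hreg.ord_pos).exists_embedding
  have h0 : K.IsStrong (c 0) := by
    refine isStrong_of_interleaved a ha' b hb' c ?_ ?_
    · intro n
      ext x
      obtain ⟨x, rfl⟩ := (toCarrier _).surjective x
      rw [Embedding.comp_apply, Embedding.comp_apply, ha, hc, hc, hb]
      exact congrArg _ ((ht n).comm x)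
    · intro n y
      obtain ⟨y, rfl⟩ := (toCarrier _).surjective y
      obtain ⟨x, hx⟩ := (ht n).covers y
      exact ⟨toCarrier _ x, by rw [hc, hb, hx]⟩
  have : c 0 = e := by
    ext x
    obtain ⟨x, rfl⟩ := (toCarrier _).surjective x
    exact (hc 0 x).trans (he x).symm
  rwa [← this]

/-- Models of level `1` which satisfy the canonical formula of stage `lam.ord` are strong in each
other as soon as they are contained in each other. -/
theorem strongLE_of_sat [Nonempty M] (hκ : ℵ₀ ≤ κ) {lam : Cardinal.{u}}
    (hreg : lam.IsRegular) (hcard : ∀ n, #(PairType K κ n) < lam) {N₁ N₂ : K.Node κ 1}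
    (f₁ : Carrier N₁ ↪[τ] M) (f₂ : Carrier N₂ ↪[τ] M)
    (h₁ : Sat K lam.ord 1 N₁ (f₁ ∘ toCarrier N₁)) (h₂ : Sat K lam.ord 1 N₂ (f₂ ∘ toCarrier N₂))
    (hle : f₁.toHom.range ≤ f₂.toHom.range) : StrongLE K f₁.toHom.range f₂.toHom.range := by
  have hr : ∀ x, ∃ y, f₂ (toCarrier N₂ y) = f₁ (toCarrier N₁ x) := fun x => hle ⟨_, rfl⟩
  choose r hr using hr
  have hcomp : (f₂ ∘ toCarrier N₂) ∘ r = f₁ ∘ toCarrier N₁ := funext hr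
  have hs : ∀ β < lam.ord, RealizedAt M β ((N₁, N₂, r) : PairType K κ 1) := fun β hβ =>
    ⟨f₂ ∘ toCarrier N₂, h₂.mono hβ.le, hcomp ▸ h₁.mono hβ.le⟩
  obtain ⟨e, he⟩ := (hs 0 hreg.ord_pos).exists_embedding
  have hes := isStrong_of_realizedAt hκ hreg hcard hs e he
  have hcomp' : f₂.comp e = f₁ := by
    ext x
    obtain ⟨x, rfl⟩ := (toCarrier N₁).surjective x
    exact (congrArg f₂ (he x)).trans (hr x)
  refine ⟨hle, (strong_comap_subtype_iff hle).1 ?_⟩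
  rw [← hcomp']
  exact (strong_comap_range_iff e f₂).2 hes

end AEC

namespace AEC

variable {τ : FirstOrder.Language.{u, u}} {K : AEC τ} {κ : Cardinal.{u}} {M : Type u}
  [τ.Structure M]

/-! ### Models of the canonical sentence belong to the class -/

/-- If `M` had at most `κ` elements, a first challenge enumerating `M` would make the level-1 node
exhaust it. The second round, available since `1 ≤ γ`, would leave no room for the new block of the
level-2 node. -/
theorem lt_mk_of_models [Nonempty M] (hκ : ℵ₀ ≤ κ) {γ : Ordinal.{u}} (hγ : 1 ≤ γ)
    (h : Models M (K.canonicalSentence κ (γ + 1))) : κ < #M := by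
  by_contra! hM
  obtain ⟨z, hz⟩ := exists_subset_range (κ := κ) (Set.univ : Set M) (by rwa [Cardinal.mk_univ])
  have v : Idx κ 0 → M := fun _ => Classical.arbitrary M
  rw [models_canonicalSentence _ v, sat_succ] at h
  obtain ⟨N, -, w, hN, hw⟩ := h z
  have h1 := hN.mono (β := 0 + 1) (by simpa using hγ)
  rw [sat_succ] at h1
  obtain ⟨N', -, w', hN', -⟩ := h1 z
  obtain ⟨f, hf⟩ := exists_embedding_of_sat hN'
  have : Nonempty (Block κ) := by
    rw [← Cardinal.mk_ne_zero_iff, Cardinal.mk_ord_toType]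
    exact (Cardinal.aleph0_pos.trans_le hκ).ne'
  let a : Block κ := Classical.arbitrary _
  obtain ⟨x, hx⟩ := hw (hz (Set.mem_univ (w' a)))
  have heq : (inc x : Idx κ 2) = (Fin.last 1, a) := by
    apply (toCarrier N').injective
    apply f.injective
    rw [hf, hf, append_inc, append_last, hx]
  have := congrArg (fun y => (y.1 : ℕ)) heq
  simp only [inc, Fin.val_castSucc, Fin.val_last] at this
  have := x.1.2
  omega

/-- The last stage of `lam.ord + 1` gives the covering by level-1 nodes; the remaining stage
`lam.ord` makes the inclusions between them strong. -/
theorem mem_of_models [Nonempty M] (hκ : ℵ₀ ≤ κ) {lam : Cardinal.{u}} (hreg : lam.IsRegular)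
    (hcard : ∀ n, #(PairType K κ n) < lam)
    (h : Models M (K.canonicalSentence κ (lam.ord + 1))) : K.Mem M := by
  have v : Idx κ 0 → M := fun _ => Classical.arbitrary M
  rw [models_canonicalSentence _ v, sat_succ] at h
  refine mem_of_covering hκ {S | ∃ (N : K.Node κ 1) (f : Carrier N ↪[τ] M),
    Sat K lam.ord 1 N (f ∘ toCarrier N) ∧ f.toHom.range = S} ?_ ?_ ?_
  · rintro _ ⟨N, f, -, rfl⟩
    exact Cardinal.mk_range_le.trans (mk_idx_le hκ 1)
  · intro A hA
    obtain ⟨z, hz⟩ := exists_subset_range A hA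
    obtain ⟨N, -, w, hN, hw⟩ := h z
    obtain ⟨f, hf⟩ := exists_embedding_of_sat hN
    have hfv : f ∘ toCarrier N = append v w := funext hf
    refine ⟨_, ⟨N, f, hfv ▸ hN, rfl⟩, hz.trans (hw.trans ?_)⟩
    rw [← hfv]
    exact Set.range_comp_subset_range _ _
  · rintro _ ⟨N, f, hN, rfl⟩ _ ⟨N', f', hN', rfl⟩ hle
    exact strongLE_of_sat hκ hreg hcard f f' hN hN' hle

/-! ### Members of the class satisfy the canonical sentence -/

theorem isNode_one (s : τ.Structure (Idx κ 1)) (hs : K.Mem (Idx κ 1)) : K.IsNode κ 1 s :=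
  ⟨hs, fun m h₁ h₂ => absurd h₂ (by omega)⟩

theorem isNode_succ {n : ℕ} (N : K.Node κ (n + 1)) (s : τ.Structure (Idx κ (n + 2)))
    (f : Carrier N ↪[τ] Idx κ (n + 2)) (hf : ∀ x, f (toCarrier N x) = inc x)
    (hs : K.IsStrong f) : K.IsNode κ (n + 2) s := by
  refine ⟨hs.mem_right, fun m h₁ h₂ => ?_⟩
  rcases (Nat.lt_succ_iff.1 h₂).eq_or_lt with rfl | hlt
  · refine ⟨f.toHom.range, ?_, hs⟩
    ext x
    constructor
    · rintro ⟨y, rfl⟩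
      obtain ⟨y, rfl⟩ := (toCarrier N).surjective y
      change ((f (toCarrier N y)).1 : ℕ) < n + 1
      rw [hf]
      exact y.1.2
    · intro hx
      exact ⟨toCarrier N (⟨x.1, hx⟩, x.2), hf _⟩
  · obtain ⟨S, hS, hSs⟩ := N.2.2 m h₁ hlt
    let S' : τ.Substructure (Carrier N) := S
    have hS' : ∀ y, toCarrier N y ∈ S' ↔ (y.1 : ℕ) < m := fun y => Set.ext_iff.1 hS y
    have hSs' : K.IsStrong S'.subtype := isStrong_subtype.2 hSs
    refine ⟨(f.comp S'.subtype).toHom.range, ?_, hs.comp hSs'⟩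
    ext x
    constructor
    · rintro ⟨⟨y, hy⟩, rfl⟩
      obtain ⟨y, rfl⟩ := (toCarrier N).surjective y
      change ((f (toCarrier N y)).1 : ℕ) < m
      rw [hf]
      exact (hS' y).1 hy
    · intro hx
      have hx' : (x.1 : ℕ) < m := hx
      exact ⟨⟨toCarrier N (⟨x.1, by omega⟩, x.2), (hS' _).2 hx'⟩, hf _⟩

/-- The assignment `v` is a strong embedding of the node `N` into `M`. -/
def StrongAt : (n : ℕ) → K.Node κ n → (Idx κ n → M) → Prop
  | 0, _, _ => True
  | _ + 1, N, v => ∃ f : Carrier N ↪[τ] M, (∀ x, f (toCarrier N x) = v x) ∧ K.IsStrong f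

theorem StrongAt.injective {n : ℕ} {N : K.Node κ n} {v : Idx κ n → M} (h : StrongAt n N v) :
    Function.Injective v := by
  cases n with
  | zero => exact fun x => x.1.elim0
  | succ n =>
    obtain ⟨f, hf, -⟩ := h
    have : v = f ∘ toCarrier N := funext fun x => (hf x).symm
    rw [this]
    exact f.injective.comp (toCarrier N).injective

theorem StrongAt.sat_zero {n : ℕ} {N : K.Node κ n} {v : Idx κ n → M} (h : StrongAt n N v) :
    Sat K 0 n N v := by
  cases n with
  | zero =>
    rw [Sat, phi_zero]
    rintro ⟨⟩
  | succ n =>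
    obtain ⟨f, hf, -⟩ := h
    exact (sat_zero_succ N v).2 ⟨f, funext hf⟩

theorem append_injective {n : ℕ} {v : Idx κ n → M} {w : Block κ → M} (hv : Function.Injective v)
    (hw : Function.Injective w) (hvw : ∀ x a, v x ≠ w a) : Function.Injective (append v w) := by
  rintro ⟨i, a⟩ ⟨j, b⟩ h
  induction i using Fin.lastCases with
  | last =>
    induction j using Fin.lastCases with
    | last =>
      rw [append_last, append_last] at h
      rw [hw h]
    | cast j =>
      rw [append_last] at h
      exact absurd ((append_inc v w (j, b)).symm.trans h.symm) (hvw _ _)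
  | cast i =>
    induction j using Fin.lastCases with
    | last =>
      rw [append_last] at h
      exact absurd ((append_inc v w (i, a)).symm.trans h) (hvw _ _)
    | cast j =>
      have := hv ((append_inc v w (i, a)).symm.trans (h.trans (append_inc v w (j, b))))
      exact congrArg inc this

/-- A strong embedding of a node can be extended to a strong embedding of a node of the next level,
if its range is exactly a given strong substructure. -/
theorem StrongAt.exists_of_range_eq {n : ℕ} {N : K.Node κ n} {v : Idx κ n → M}
    (h : StrongAt n N v) {w : Block κ → M} (hinj : Function.Injective (append v w))
    (S : τ.Substructure M) (hS : K.Strong S) (hr : Set.range (append v w) = S) :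
    ∃ N' : K.Node κ (n + 1), Node.Below K n N N' ∧ StrongAt (n + 1) N' (append v w) := by
  let e : Idx κ (n + 1) ≃ S := (Equiv.ofInjective _ hinj).trans (Equiv.setCongr hr)
  let s : τ.Structure (Idx κ (n + 1)) := e.symm.inducedStructure
  let E : S ≃[τ] Idx κ (n + 1) := e.symm.inducedStructureEquiv
  let g : Idx κ (n + 1) ↪[τ] M := S.subtype.comp E.symm.toEmbedding
  have hg : ∀ x, g x = append v w x := fun x => rfl
  have hgs : K.IsStrong g := (IsStrong.comp_equiv_iff _ _).2 (isStrong_subtype.2 hS)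
  cases n with
  | zero => exact ⟨⟨s, isNode_one s hgs.mem_left⟩, trivial, g, hg, hgs⟩
  | succ n =>
    obtain ⟨f, hf, hfs⟩ := h
    have hfS : ∀ x, f x ∈ S := fun x => by
      obtain ⟨x, rfl⟩ := (toCarrier N).surjective x
      rw [hf, ← append_inc v w, ← SetLike.mem_coe, ← hr]
      exact ⟨_, rfl⟩
    let i : Carrier N ↪[τ] Idx κ (n + 2) := E.toEmbedding.comp (f.codRestrict S hfS)
    have hgi : g.comp i = f := by
      ext x
      change ((E.symm (E (f.codRestrict S hfS x)) : S) : M) = f x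
      rw [Language.Equiv.symm_apply_apply, Embedding.codRestrict_apply]
    have hi : ∀ x, i (toCarrier N x) = inc x := fun x => by
      apply g.injective
      rw [← Embedding.comp_apply, hgi, hf, hg, append_inc]
    -- Both nodes are strong in `M`, so coherence makes the old one strong in the new one.
    have his : K.IsStrong i := IsStrong.of_comp (hgi ▸ hfs) hgs
    exact ⟨⟨s, isNode_succ N s i hi his⟩, ⟨i, hi, his⟩, g, hg, hgs⟩

/-- Since `M` has more than `κ` elements, a set `Y` of `κ` fresh ones can be put into the strong
substructure `S`. Then `S` minus the old range has exactly `κ` elements, and the new block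
enumerates it bijectively. -/
theorem StrongAt.exists_extension (hκ : ℵ₀ ≤ κ) (hM : κ < #M)
    (hL : ∀ A : Set M, ∃ S : τ.Substructure M, A ⊆ S ∧ K.Strong S ∧ #S ≤ #A + κ)
    {n : ℕ} {N : K.Node κ n} {v : Idx κ n → M} (h : StrongAt n N v) (z : Block κ → M) :
    ∃ N' : K.Node κ (n + 1), Node.Below K n N N' ∧ ∃ w : Block κ → M,
      StrongAt (n + 1) N' (append v w) ∧ Set.range z ⊆ Set.range (append v w) := by
  have hv : #(Set.range v) ≤ κ := Cardinal.mk_range_le.trans (mk_idx_le hκ n)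
  have hz : #(Set.range z) ≤ κ := by simpa using Cardinal.mk_range_le (f := z)
  have hcompl : κ ≤ #((Set.range v)ᶜ : Set M) := by
    by_contra! hlt
    refine hM.not_ge ?_
    rw [← Cardinal.mk_sum_compl (Set.range v)]
    exact Cardinal.add_le_of_le hκ hv hlt.le
  obtain ⟨Y, hY, hYc⟩ := Cardinal.le_mk_iff_exists_subset.1 hcompl
  obtain ⟨S, hAS, hS, hSc⟩ := hL (Set.range v ∪ Set.range z ∪ Y)
  have hA : #(Set.range v ∪ Set.range z ∪ Y : Set M) ≤ κ :=
    (Cardinal.mk_union_le _ _).trans (Cardinal.add_le_of_le hκ ((Cardinal.mk_union_le _ _).trans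
      (Cardinal.add_le_of_le hκ hv hz)) hYc.le)
  have hSκ : #S ≤ κ := hSc.trans (Cardinal.add_le_of_le hκ hA le_rfl)
  have hD : #(Block κ) = #((S : Set M) \ Set.range v : Set M) := by
    rw [Cardinal.mk_ord_toType]
    refine le_antisymm ?_ ((Cardinal.mk_le_mk_of_subset Set.sdiff_subset).trans hSκ)
    exact hYc.ge.trans <| Cardinal.mk_le_mk_of_subset fun y hy => ⟨hAS (Or.inr hy), hY hy⟩
  obtain ⟨e⟩ := Cardinal.eq.1 hD
  have hw : Set.range (fun a => (e a : M)) = (S : Set M) \ Set.range v :=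
    (e.surjective.range_comp Subtype.val).trans Subtype.range_coe
  have hinj : Function.Injective (append v fun a => (e a : M)) :=
    append_injective h.injective (Subtype.val_injective.comp e.injective)
      fun x a hxa => (e a).2.2 ⟨x, hxa⟩
  have hr : Set.range (append v fun a => (e a : M)) = S := by
    rw [range_append, hw, Set.union_sdiff_cancel]
    exact fun x hx => hAS (Or.inl (Or.inl hx))
  obtain ⟨N', hN', hs⟩ := h.exists_of_range_eq hinj S hS hr
  refine ⟨N', hN', _, hs, ?_⟩
  rw [hr]
  exact fun x hx => hAS (Or.inl (Or.inr hx))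

theorem StrongAt.sat (hκ : ℵ₀ ≤ κ) (hM : κ < #M)
    (hL : ∀ A : Set M, ∃ S : τ.Substructure M, A ⊆ S ∧ K.Strong S ∧ #S ≤ #A + κ)
    (γ : Ordinal.{u}) {n : ℕ} {N : K.Node κ n} {v : Idx κ n → M} (h : StrongAt n N v) :
    Sat K γ n N v := by
  induction γ using Ordinal.limitRecOn generalizing n with
  | zero => exact h.sat_zero
  | add_one γ ih =>
    rw [sat_succ]
    intro z
    obtain ⟨N', hN', w, hs, hz⟩ := h.exists_extension hκ hM hL z
    exact ⟨N', hN', w, ih hs, hz⟩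
  | limit γ hγ ih => exact (sat_limit hγ N v).2 fun β hβ => ih β hβ h

theorem LST_spec (K : AEC τ) : ℵ₀ ≤ K.LST ∧ ∀ {M : Type u} [τ.Structure M], K.Mem M →
    ∀ A : Set M, ∃ S : τ.Substructure M, A ⊆ S ∧ K.Strong S ∧ #S ≤ #A + K.LST :=
  csInf_mem (s := {κ : Cardinal.{u} | ℵ₀ ≤ κ ∧ ∀ {M : Type u} [τ.Structure M], K.Mem M →
    ∀ A : Set M, ∃ S : τ.Substructure M, A ⊆ S ∧ K.Strong S ∧ #S ≤ #A + κ}) K.exists_lst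

theorem models_of_mem [Nonempty M] (hK : K.LST ≤ κ) (hM : K.Mem M) (hκM : κ < #M)
    (γ : Ordinal.{u}) : Models M (K.canonicalSentence κ γ) := by
  rw [models_canonicalSentence γ fun _ => Classical.arbitrary M]
  refine StrongAt.sat (K.LST_spec.1.trans hK) hκM (fun A => ?_) γ trivial
  obtain ⟨S, hAS, hS, hc⟩ := K.LST_spec.2 hM A
  exact ⟨S, hAS, hS, hc.trans (by gcongr)⟩

end AEC

/-! ### Counting formulas -/

section Counting

variable {τ : FirstOrder.Language.{u, u}} {κ : Cardinal.{u}}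

theorem mk_sigma_le {ι : Type u} {f : ι → Type u} (hκ : ℵ₀ ≤ κ) (hι : #ι ≤ κ)
    (hf : ∀ i, #(f i) ≤ κ) : #(Σ i, f i) ≤ κ := by
  rw [Cardinal.mk_sigma]
  refine (Cardinal.sum_le_sum _ (fun _ => κ) hf).trans ?_
  rw [Cardinal.sum_const']
  exact Cardinal.mul_le_of_le hκ hι le_rfl

theorem mk_fin_fun_le (hκ : ℵ₀ ≤ κ) {X : Type u} (hX : #X ≤ κ) (n : ℕ) : #(Fin n → X) ≤ κ := by
  rw [Cardinal.mk_pi, Cardinal.prod_const]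
  simp only [Cardinal.mk_fin, Cardinal.lift_natCast, Cardinal.lift_uzero]
  exact (Cardinal.power_le_power_right hX).trans (Cardinal.power_nat_le hκ)

theorem mk_sum_le {X Y : Type u} (hκ : ℵ₀ ≤ κ) (hX : #X ≤ κ) (hY : #Y ≤ κ) : #(X ⊕ Y) ≤ κ := by
  rw [Cardinal.mk_sum, Cardinal.lift_id, Cardinal.lift_id]
  exact Cardinal.add_le_of_le hκ hX hY

theorem mk_prod_le {X Y : Type u} (hκ : ℵ₀ ≤ κ) (hX : #X ≤ κ) (hY : #Y ≤ κ) : #(X × Y) ≤ κ := by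
  rw [Cardinal.mk_prod, Cardinal.lift_id, Cardinal.lift_id]
  exact Cardinal.mul_le_of_le hκ hX hY

theorem mk_functions_le (hτ : τ.card ≤ κ) : #(Σ l, τ.Functions l) ≤ κ :=
  (Cardinal.mk_le_of_injective (f := fun x => (Sum.inl x : τ.Symbols)) Sum.inl_injective).trans hτ

theorem mk_relations_le (hτ : τ.card ≤ κ) : #(Σ l, τ.Relations l) ≤ κ :=
  (Cardinal.mk_le_of_injective (f := fun x => (Sum.inr x : τ.Symbols)) Sum.inr_injective).trans hτ

/-- A structure is determined by the graphs of its functions and relations, that is, by a subset of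
a set of size at most `κ`. -/
theorem mk_structure_le (hκ : ℵ₀ ≤ κ) (hτ : τ.card ≤ κ) {X : Type u} (hX : #X ≤ κ) :
    #(τ.Structure X) ≤ 2 ^ κ := by
  let T := (Σ p : (Σ l, τ.Functions l), (Fin p.1 → X) × X) ⊕
    (Σ p : (Σ l, τ.Relations l), (Fin p.1 → X))
  have hT : #T ≤ κ := by
    refine mk_sum_le hκ (mk_sigma_le hκ (mk_functions_le hτ) fun p => ?_)
      (mk_sigma_le hκ (mk_relations_le hτ) fun p => mk_fin_fun_le hκ hX _)
    exact mk_prod_le hκ (mk_fin_fun_le hκ hX _) hX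
  let G : τ.Structure X → Set T := fun s => {t | Sum.elim
    (fun p => @Structure.funMap τ X s _ p.1.2 p.2.1 = p.2.2)
    (fun p => @Structure.RelMap τ X s _ p.1.2 p.2) t}
  have hG : Function.Injective G := by
    intro s s' h
    have h' := Set.ext_iff.1 h
    refine Structure.ext ?_ ?_
    · funext n f x
      exact ((h' (Sum.inl ⟨⟨n, f⟩, x, @Structure.funMap τ X s _ f x⟩)).1 rfl).symm
    · funext n R x
      exact propext (h' (Sum.inr ⟨⟨n, R⟩, x⟩))
  refine (Cardinal.mk_le_of_injective hG).trans ?_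
  rw [Cardinal.mk_set]
  exact Cardinal.power_le_power_left two_ne_zero hT

theorem mk_atomicFormula_le (hκ : ℵ₀ ≤ κ) (hτ : τ.card ≤ κ) {α : Type u} (hα : #α ≤ κ) :
    #(AtomicFormula τ α) ≤ κ := by
  have hterm : #(τ.Term α) ≤ κ :=
    Term.card_le.trans (max_le hκ (mk_sum_le hκ hα (mk_functions_le hτ)))
  let T := (τ.Term α × τ.Term α) ⊕ (Σ p : (Σ l, τ.Relations l), (Fin p.1 → τ.Term α))
  have hT : #T ≤ κ := mk_sum_le hκ (mk_prod_le hκ hterm hterm)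
    (mk_sigma_le hκ (mk_relations_le hτ) fun p => mk_fin_fun_le hκ hterm _)
  let G : T → AtomicFormula τ α :=
    Sum.elim (fun p => .equal p.1 p.2) (fun p => .rel p.1.2 p.2)
  have hG : Function.Surjective G := by
    rintro (⟨t₁, t₂⟩ | ⟨R, ts⟩)
    exacts [⟨Sum.inl (t₁, t₂), rfl⟩, ⟨Sum.inr ⟨⟨_, R⟩, ts⟩, rfl⟩]
  exact (Cardinal.mk_le_of_surjective hG).trans hT

namespace AEC

variable {K : AEC τ}

theorem mk_node_le (hκ : ℵ₀ ≤ κ) (hτ : τ.card ≤ κ) (n : ℕ) : #(K.Node κ n) ≤ 2 ^ κ := by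
  cases n with
  | zero =>
    refine (Cardinal.mk_punit).le.trans ?_
    exact Cardinal.one_le_iff_ne_zero.2 (Cardinal.power_ne_zero _ two_ne_zero)
  | succ n => exact (Cardinal.mk_subtype_le _).trans (mk_structure_le hκ hτ (mk_idx_le hκ _))

theorem mk_pairType_le (hκ : ℵ₀ ≤ κ) (hτ : τ.card ≤ κ) (n : ℕ) : #(PairType K κ n) ≤ 2 ^ κ := by
  have h2 : ℵ₀ ≤ (2 : Cardinal.{u}) ^ κ := hκ.trans (Cardinal.cantor κ).le
  refine mk_prod_le h2 (mk_node_le hκ hτ n) (mk_prod_le h2 (mk_node_le hκ hτ n) ?_)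
  rw [Cardinal.mk_pi, Cardinal.prod_const']
  calc #(Idx κ n) ^ #(Idx κ n) ≤ κ ^ #(Idx κ n) := Cardinal.power_le_power_right (mk_idx_le hκ n)
    _ ≤ κ ^ κ :=
      Cardinal.power_le_power_left (Cardinal.aleph0_pos.trans_le hκ).ne' (mk_idx_le hκ n)
    _ = 2 ^ κ := Cardinal.power_self_eq hκ

theorem inLogic_diagram {μ θ : Cardinal.{u}} (hκ : ℵ₀ ≤ κ) (hτ : τ.card ≤ κ) (hμ : κ < μ)
    {α : Type u} (hα : #α ≤ κ) (s : τ.Structure α) : (diagram s).InLogic μ θ := by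
  refine ⟨lt_of_le_of_lt ((Cardinal.mk_subtype_le _).trans ?_) hμ, fun ⟨⟨a, b⟩, _⟩ => ?_⟩
  · rw [Cardinal.mk_prod, Cardinal.lift_uzero]
    refine Cardinal.mul_le_of_le hκ (mk_atomicFormula_le hκ hτ hα) ?_
    exact (Cardinal.lift_lt_aleph0.2 (Cardinal.lt_aleph0_of_finite Bool)).le.trans hκ
  · cases b <;> trivial

theorem inLogic_and {μ θ : Cardinal.{u}} (hμ : ℵ₀ ≤ μ) {α : Type u} {φ ψ : InfFormula τ α}
    (hφ : φ.InLogic μ θ) (hψ : ψ.InLogic μ θ) : (φ.and ψ).InLogic μ θ := by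
  refine ⟨(Cardinal.lt_aleph0_of_finite _).trans_le hμ, ?_⟩
  rintro ⟨_ | _⟩
  exacts [hψ, hφ]

/-- Diagrams have at most `κ` conjuncts, successor stages at most `2 ^ κ` disjuncts (one per
admissible node), and a limit stage `γ` has `γ.card` conjuncts. -/
theorem inLogic_phi (hκ : ℵ₀ ≤ κ) (hτ : τ.card ≤ κ) {lam : Cardinal.{u}} (hlam : 2 ^ κ ≤ lam)
    (γ : Ordinal.{u}) (hγ : γ.card ≤ lam) (n : ℕ) (N : K.Node κ n) :
    (K.phi κ γ n N).InLogic (Order.succ lam) (Order.succ κ) := by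
  have hκlam : κ < Order.succ lam := ((Cardinal.cantor κ).trans_le hlam).trans (Order.lt_succ lam)
  have hblock : #(Block κ) < Order.succ κ := by simp
  induction γ using Ordinal.limitRecOn generalizing n with
  | zero =>
    rw [phi_zero]
    cases n with
    | zero => exact ⟨by simp, fun i => i.elim⟩
    | succ n => exact inLogic_diagram hκ hτ hκlam (mk_idx_le hκ _) N.1
  | add_one γ ih =>
    rw [phi_succ]
    refine ⟨hblock, ?_, fun N' => ⟨hblock, inLogic_and (hκ.trans hκlam.le)
      (InfFormula.inLogic_relabel _ _ (ih ?_ _ _))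
      ⟨by simpa using hκlam, fun a => ⟨(mk_idx_le hκ _).trans_lt hκlam, fun d => trivial⟩⟩⟩⟩
    · exact ((Cardinal.mk_subtype_le _).trans ((mk_node_le hκ hτ _).trans hlam)).trans_lt
        (Order.lt_succ lam)
    · exact (Ordinal.card_le_card (Order.le_succ γ)).trans hγ
  | limit γ hlim ih =>
    rw [phi_limit hlim]
    refine ⟨?_, fun i => ih _ ((equivShrink (Set.Iio γ)).symm i).2 ?_ _ _⟩
    · refine lt_of_le_of_lt (le_trans ?_ hγ) (Order.lt_succ lam)
      rw [← Cardinal.lift_le.{u + 1}, Cardinal.lift_mk_shrink'', Cardinal.mk_Iio_ordinal]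
    · exact (Ordinal.card_le_card (le_of_lt ((equivShrink (Set.Iio γ)).symm i).2)).trans hγ

theorem inLogic_canonicalSentence (hκ : ℵ₀ ≤ κ) (hτ : τ.card ≤ κ) {lam : Cardinal.{u}}
    (hlam : 2 ^ κ ≤ lam) (γ : Ordinal.{u}) (hγ : γ.card ≤ lam) :
    (K.canonicalSentence κ γ).InLogic (Order.succ lam) (Order.succ κ) :=
  InfFormula.inLogic_relabel _ _ (inLogic_phi hκ hτ hlam γ hγ _ _)

/-! ### Small models -/

/-- The members of the class whose universe is a subset of a fixed set of cardinality `κ`. -/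
abbrev SmallModel (K : AEC τ) (κ : Cardinal.{u}) : Type u :=
  Σ A : Set (Block κ), {_s : τ.Structure A // K.Mem A}

/-- The sentence which describes a structure up to isomorphism, by quantifying over an enumeration of
its elements. -/
def isoSentence {A : Type u} (s : τ.Structure A) : InfSentence τ :=
  InfFormula.ex (β := A) (InfFormula.and ((diagram s).relabel Sum.inr)
    (InfFormula.all (β := PUnit.{u + 1}) (InfFormula.disj (ι := A) fun a =>
      InfFormula.varEq (Sum.inl (Sum.inr a)) (Sum.inr PUnit.unit))))

theorem models_isoSentence {M A : Type u} [τ.Structure M] [s : τ.Structure A] :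
    Models M (isoSentence s) ↔ Nonempty (A ≃[τ] M) := by
  simp only [Models, isoSentence, InfFormula.Realize, InfFormula.realize_and,
    InfFormula.realize_relabel, InfFormula.realize_varEq, realize_diagram, Sum.elim_comp_inr,
    Sum.elim_inl, Sum.elim_inr]
  constructor
  · rintro ⟨w, ⟨f, rfl⟩, h⟩
    have hsurj : Function.Surjective f := fun y => h fun _ => y
    exact ⟨{ Equiv.ofBijective f ⟨f.injective, hsurj⟩ with
      map_fun' := f.map_fun'
      map_rel' := f.map_rel' }⟩
  · rintro ⟨e⟩
    exact ⟨e, ⟨e.toEmbedding, rfl⟩, fun y => e.surjective _⟩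

/-- The disjunction of a sentence, which describes the large members of the class, and of the
descriptions of the members of cardinality at most `κ`. -/
def withSmallModels (K : AEC τ) (κ : Cardinal.{u}) (φ : InfSentence τ) : InfSentence τ :=
  InfFormula.disj (ι := Option (SmallModel K κ)) fun i => i.elim φ fun A => isoSentence A.2.1

theorem models_withSmallModels {M : Type u} [τ.Structure M] (φ : InfSentence τ) :
    Models M (withSmallModels K κ φ) ↔ Models M φ ∨ (K.Mem M ∧ #M ≤ κ) := by
  have h : Models M (withSmallModels K κ φ) ↔
      Models M φ ∨ ∃ A : SmallModel K κ, Models M (isoSentence A.2.1) := Option.exists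
  rw [h]
  refine or_congr_right ⟨?_, ?_⟩
  · rintro ⟨⟨A, s, hA⟩, h⟩
    obtain ⟨e⟩ := models_isoSentence.1 h
    refine ⟨K.mem_of_equiv e hA, ?_⟩
    rw [← Cardinal.mk_congr e.toEquiv]
    exact (Cardinal.mk_subtype_le _).trans (Cardinal.mk_ord_toType κ).le
  · rintro ⟨hM, hc⟩
    have hc' : #M ≤ #(Block κ) := by rwa [Cardinal.mk_ord_toType]
    obtain ⟨f⟩ := hc'
    let e : M ≃ Set.range f := Equiv.ofInjective f f.injective
    let s : τ.Structure (Set.range f) := e.inducedStructure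
    let E : M ≃[τ] Set.range f := e.inducedStructureEquiv
    exact ⟨⟨Set.range f, s, K.mem_of_equiv E hM⟩, models_isoSentence.2 ⟨E.symm⟩⟩

theorem mk_smallModel_le (hκ : ℵ₀ ≤ κ) (hτ : τ.card ≤ κ) : #(SmallModel K κ) ≤ 2 ^ κ := by
  refine mk_sigma_le (hκ.trans (Cardinal.cantor κ).le) (by simp) fun A => ?_
  refine (Cardinal.mk_subtype_le _).trans (mk_structure_le hκ hτ ?_)
  exact (Cardinal.mk_subtype_le _).trans (Cardinal.mk_ord_toType κ).le

theorem inLogic_withSmallModels (hκ : ℵ₀ ≤ κ) (hτ : τ.card ≤ κ) {lam : Cardinal.{u}}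
    (hlam : 2 ^ κ ≤ lam) {φ : InfSentence τ} (hφ : φ.InLogic (Order.succ lam) (Order.succ κ)) :
    (withSmallModels K κ φ).InLogic (Order.succ lam) (Order.succ κ) := by
  have hκlam : κ < Order.succ lam := ((Cardinal.cantor κ).trans_le hlam).trans (Order.lt_succ lam)
  have hℵ : ℵ₀ ≤ lam := hκ.trans ((Cardinal.cantor κ).le.trans hlam)
  refine ⟨?_, ?_⟩
  · rw [Cardinal.mk_option, Order.lt_succ_iff]
    exact Cardinal.add_le_of_le hℵ ((mk_smallModel_le hκ hτ).trans hlam)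
      (Cardinal.one_le_aleph0.trans hℵ)
  · rintro (_ | ⟨A, s, hA⟩)
    · exact hφ
    · have hAκ : #A ≤ κ := (Cardinal.mk_subtype_le _).trans (Cardinal.mk_ord_toType κ).le
      refine ⟨Order.lt_succ_iff.2 hAκ, inLogic_and (hκ.trans hκlam.le)
        (InfFormula.inLogic_relabel _ _ (inLogic_diagram hκ hτ hκlam hAκ s))
        ⟨?_, ?_, fun _ => trivial⟩⟩
      · rw [Cardinal.mk_punit, Order.lt_succ_iff]
        exact Cardinal.one_le_aleph0.trans hκ
      · exact hAκ.trans_lt hκlam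

end AEC

end Counting

end AECDef

/-! ### Both axiomatizations, for `lam` equal to `ℶ₂(κ)⁺⁺` -/

theorem theorem2p1 {τ : FirstOrder.Language.{u, u}} (K : AECDef.AEC τ) (κ lam : Cardinal.{u})
    (hK : K.LST ≤ κ) (hτ : τ.card ≤ κ) (hlam : lam = AECDef.bethTwoSuccSucc κ) :
    (∃ ψ : AECDef.InfSentence τ, ψ.InLogic (Order.succ lam) (Order.succ κ) ∧
      ∀ (M : Type u) [τ.Structure M] [Nonempty M], K.Mem M ↔ AECDef.Models M ψ) ∧
    (K.canonicalSentence κ (lam.ord + 1)).InLogic (Order.succ lam) (Order.succ κ) ∧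
    (∀ (M : Type u) [τ.Structure M] [Nonempty M],
      AECDef.Models M (K.canonicalSentence κ (lam.ord + 1)) ↔ K.Mem M ∧ κ < Cardinal.mk M) := by
  have hκ : Cardinal.aleph0 ≤ κ := K.LST_spec.1.trans hK
  have hbeth : (2 : Cardinal.{u}) ^ κ < 2 ^ ((2 : Cardinal.{u}) ^ κ) := Cardinal.cantor _
  have hsucc : 2 ^ ((2 : Cardinal.{u}) ^ κ) < lam := by
    rw [hlam]
    exact (Order.lt_succ _).trans (Order.lt_succ _)
  have h2 : (2 : Cardinal.{u}) ^ κ < lam := hbeth.trans hsucc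
  -- A successor cardinal is regular; with `2 ^ κ < lam` this is what the pigeonhole on pair types
  -- requires.
  have hreg : lam.IsRegular := by
    rw [hlam]
    exact Cardinal.isRegular_succ
      (hκ.trans ((Cardinal.cantor κ).le.trans (hbeth.le.trans (Order.le_succ _))))
  have hlog : (K.canonicalSentence κ (lam.ord + 1)).InLogic (Order.succ lam) (Order.succ κ) := by
    refine AECDef.AEC.inLogic_canonicalSentence hκ hτ h2.le _ ?_
    rw [Ordinal.card_add, Cardinal.card_ord, Ordinal.card_one]
    exact (Cardinal.add_one_eq hreg.aleph0_le).le
  have hmodels : ∀ (M : Type u) [τ.Structure M] [Nonempty M],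
      AECDef.Models M (K.canonicalSentence κ (lam.ord + 1)) ↔ K.Mem M ∧ κ < Cardinal.mk M := by
    intro M _ _
    refine ⟨fun h => ⟨?_, ?_⟩, fun h => AECDef.AEC.models_of_mem hK h.1 h.2 _⟩
    · exact AECDef.AEC.mem_of_models hκ hreg
        (fun n => (AECDef.AEC.mk_pairType_le hκ hτ n).trans_lt h2) h
    · refine AECDef.AEC.lt_mk_of_models hκ ?_ h
      rw [← Cardinal.ord_one]
      exact Cardinal.ord_le_ord.2 (Cardinal.one_le_aleph0.trans hreg.aleph0_le)
  refine ⟨⟨AECDef.AEC.withSmallModels K κ _,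
    AECDef.AEC.inLogic_withSmallModels hκ hτ h2.le hlog, fun M _ _ => ?_⟩, hlog, hmodels⟩
  rw [AECDef.AEC.models_withSmallModels, hmodels M, ← and_or_left]
  exact (and_iff_left (lt_or_ge _ _)).symm
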